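/- Fix an integer $r\ge 2$. **Definitions.** Let $X$ be a compact metrizable space, $T:X\to X$ continuous and $x\in X$. Let $\mathcal M_x$ be the set of Borel probability measures $\mu$ on $X$ that are *quasi-generated* by $x$, i.e. such that $\frac1{n_k}\sum_{i=0}^{n_k-1}\delta_{T^ix}\to\mu$ in the weak* topology for some strictly increasing sequence $(n_k)$; such measures are $T$-invariant. If the convergence holds along all $n\to\infty$, then $x$ is *generic* for $\mu$. With $h(\mu)$ the Kolmogorov–Sinai entropy (logarithms in base $2$) of $\mu$ with respect to $T$, put $\underline h(x)=\inf\{h(\mu):\mu\in\mathcal M_x\}$ and $\overline h(x)=\sup\{h(\mu):\mu\in\mathcal M_x\}$; if the two agree, the common value is denoted $h(x)$ and $h(x)$ is said to exist. The point $x$ is *deterministic* if $h(\mu)=0$ for all $\mu\in\mathcal M_x$. For $x\in\mathbb R$ let $\omega_r(x)\in\{0,\dots,r-1\}^{\mathbb N}$ be the sequence of base-$r$ digits of the fractional part of $x$ (not ending in $r-1$ repeated). The number $x$ is *normal in base $r$* if every block of length $k$ over $\{0,\dots,r-1\}$ occurs in $\omega_r(x)$ with frequency $r^{-k}$, for every $k\in\mathbb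 N$, and *deterministic in base $r$* if $\omega_r(x)$ is a deterministic point of $\{0,\dots,r-1\}^{\mathbb N}$ under the shift. Let $\mathcal N(r)$ and $\mathcal D(r)$ be the sets of real numbers that are normal, respectively deterministic, in base $r$. Let $\mathbb T=\mathbb R/\mathbb Z$ and $R(t)=rt$. Let $\mathcal N(\mathbb T,R)$ be the set of points of $\mathbb T$ that are generic under $R$ for Lebesgue measure and $\mathcal D(\mathbb T,R)$ the set of points of $\mathbb T$ that are deterministic under $R$. For $t\in\mathbb T$, $\underline h(t)$, $\overline h(t)$ and $h(t)$ refer to the system $(\mathbb T,R)$. For a subset $S$ of $\mathbb R$ or of $\mathbb T$ let $S^\perp=\{y: x+y\in S\text{ for every }x\in S\}$; write $\mathcal N^\perp(r)=\mathcal N(r)^\perp$, $\mathcal D^\perp(r)=\mathcal D(r)^\perp$, $\mathcal N^\perp(\mathbb T,R)=\mathcal N(\mathbb T,R)^\perp$, $\mathcal D^\perp(\mathbb T,R)=\mathcal D(\mathbb T,R)^\perp$. **Statement A (real numbers).** 1. $\mathcal D(r)\subset\mathcal N^\perp(r)$: if $y$ is deterministic in base $r$ and $x$ is normal in base $r$,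 then $x+y$ is normal in base $r$. 2. $\mathcal D(r)=\mathcal D^\perp(r)$, and $\mathcal D(r)$ is a subgroup of $(\mathbb R,+)$. **Statement B (the circle).** 1. If $x,y\in\mathbb T$ and $h(x)$ and $h(y)$ exist, then $|h(x)-h(y)|\le\underline h(x+y)\le\overline h(x+y)\le h(x)+h(y)$. 2. An element $y\in\mathbb T$ is in $\mathcal D(\mathbb T,R)$ if and only if $\underline h(x+y)=\underline h(x)$ and $\overline h(x+y)=\overline h(x)$ for every $x\in\mathbb T$. 3. $\mathcal D(\mathbb T,R)\subset\mathcal N^\perp(\mathbb T,R)$. 4. $\mathcal D(\mathbb T,R)=\mathcal D^\perp(\mathbb T,R)$, and $\mathcal D(\mathbb T,R)$ is a subgroup of $\mathbb T$. -/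

import Mathlib

open MeasureTheory Filter Topology
open scoped ENNReal

namespace NormDet

noncomputable section

/-! Kolmogorov-Sinai entropy (logarithms in base two). -/

section Entropy

variable {X : Type*} [MeasurableSpace X]

/-- Shannon entropy `-∑ μ(A) log₂ μ(A)` of the finite partition of `X` into the fibres of a
map `P` to a finite set of labels (empty fibres contribute `0`). -/
def shannonEntropy (μ : Measure X) {ι : Type*} [Fintype ι] (P : X → ι) : ℝ :=
  ∑ a, Real.negMulLog (μ.real (P ⁻¹' {a})) / Real.log 2

/-- The partition `⋁_{i < n} T⁻ⁱ P`, labelled by the itineraries of length `n`. -/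
def iteratedPartition (T : X → X) {ι : Type*} (P : X → ι) (n : ℕ) : X → (Fin n → ι) :=
  fun x i => P (T^[i] x)

/-- The dynamical entropy `lim (1/n) H_μ(P^n)` of a finite partition. It is written as a limsup;
for `T`-invariant `μ` the limit exists by subadditivity. -/
def partitionEntropy (μ : Measure X) (T : X → X) {ι : Type*} [Fintype ι] (P : X → ι) : ℝ≥0∞ :=
  limsup (fun n : ℕ => ENNReal.ofReal (shannonEntropy μ (iteratedPartition T P n) / n)) atTop

/-- The Kolmogorov-Sinai entropy `h_μ(T)`: the supremum of the dynamical entropies over all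
finite measurable partitions. -/
def measureEntropy (μ : Measure X) (T : X → X) : ℝ≥0∞ :=
  ⨆ (k : ℕ) (P : X → Fin k) (_ : Measurable P), partitionEntropy μ T P

end Entropy

/-! Points of a topological dynamical system. -/

section Points

variable {X : Type*} [TopologicalSpace X] [MeasurableSpace X]

/-- `x` generates `μ` along the sequence `J`: the measures `(1/n) ∑_{i < n} δ_{Tⁱ x}` converge
to `μ` in the weak* topology along `n = J k`, `k → ∞`. -/
def GeneratesAlong (T : X → X) (x : X) (J : ℕ → ℕ) (μ : ProbabilityMeasure X) : Prop :=
  ∀ f : C(X, ℝ), Tendsto (fun k => birkhoffAverage ℝ T f (J k) x) atTop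
    (𝓝 (∫ z, f z ∂(μ : Measure X)))

/-- `x` is generic for `μ`. -/
def IsGeneric (T : X → X) (x : X) (μ : ProbabilityMeasure X) : Prop :=
  GeneratesAlong T x (fun n => n) μ

/-- The set `M_x` of the measures that are quasi-generated by `x`. -/
def quasiGenerated (T : X → X) (x : X) : Set (ProbabilityMeasure X) :=
  {μ | ∃ J : ℕ → ℕ, StrictMono J ∧ GeneratesAlong T x J μ}

/-- The lower entropy of a point. -/
def lowerEntropy (T : X → X) (x : X) : ℝ≥0∞ :=
  ⨅ μ ∈ quasiGenerated T x, measureEntropy (μ : Measure X) T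

/-- The upper entropy of a point. -/
def upperEntropy (T : X → X) (x : X) : ℝ≥0∞ :=
  ⨆ μ ∈ quasiGenerated T x, measureEntropy (μ : Measure X) T

/-- A point is deterministic if all measures that it quasi-generates have entropy zero. -/
def IsDeterministic (T : X → X) (x : X) : Prop :=
  ∀ μ ∈ quasiGenerated T x, measureEntropy (μ : Measure X) T = 0

end Points

/-- For a subset `S` of an additive group, the set `S^⊥` of the elements `y` that preserve `S`:
`x + y ∈ S` for every `x ∈ S`. -/
def preservers {G : Type*} [Add G] (S : Set G) : Set G :=
  {y | ∀ x ∈ S, x + y ∈ S}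

/-! Real numbers, through their base `r` expansions. -/

/-- The shift on sequences. -/
def shift {A : Type*} (ω : ℕ → A) : ℕ → A := fun n => ω (n + 1)

/-- A sequence over `r` symbols is normal if every block of length `k` occurs in it with
frequency `r^{-k}`. -/
def IsNormalSeq {r : ℕ} (ω : ℕ → Fin r) : Prop :=
  ∀ (k : ℕ) (B : Fin k → Fin r),
    Tendsto (fun n : ℕ =>
        (((Finset.range n).filter (fun i => ∀ j : Fin k, ω (i + j) = B j)).card : ℝ) / n)
      atTop (𝓝 (((r : ℝ) ^ k)⁻¹))

/-- The symbolic alias of a real number in base `r`: the digits of its fractional part after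
the point (of two possible expansions, the one that ends with zeros). -/
def digitAlias (r : ℕ) [NeZero r] (x : ℝ) : ℕ → Fin r :=
  Real.digits (Int.fract x) r

/-- The set `N(r)` of the real numbers that are normal in base `r`. -/
def normalNumbers (r : ℕ) [NeZero r] : Set ℝ :=
  {x | IsNormalSeq (digitAlias r x)}

/-- The set `D(r)` of the real numbers that are deterministic in base `r`. -/
def deterministicNumbers (r : ℕ) [NeZero r] : Set ℝ :=
  {x | IsDeterministic (shift : (ℕ → Fin r) → (ℕ → Fin r)) (digitAlias r x)}

/-! The system on the circle `ℝ / ℤ`. -/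

/-- The transformation `t ↦ r t` of the circle. -/
def circleMul (r : ℕ) : UnitAddCircle → UnitAddCircle := fun t => r • t

/-- Lebesgue measure on the circle, of total mass one. -/
def circleLebesgue : ProbabilityMeasure UnitAddCircle := 
  ⟨volume, ⟨UnitAddCircle.measure_univ⟩⟩

/-- The set of the points of the circle that are generic for Lebesgue measure. -/
def circleNormal (r : ℕ) : Set UnitAddCircle :=
  {t | IsGeneric (circleMul r) t circleLebesgue}

/-- The set of the deterministic points of the circle. -/
def circleDeterministic (r : ℕ) : Set UnitAddCircle :=
  {t | IsDeterministic (circleMul r) t}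

end

end NormDet

/-! Adding two base `r` numbers involves carries, but seen at precision `r ^ (-n)` the whole effect
is a single carry. Cut the circle into `r ^ n` intervals indexed by `ZMod (r ^ n)`: the index of `s
+ t` is the sum of the indices of `s` and `t`, or that sum plus one (`cell_add`). So of the three
indices any two determine the third up to one bit. The first `n` digits and the index of the
interval are the same datum, and the digit partition generates; hence the entropy of an invariant
measure is the growth rate of the Shannon entropies of these partitions
(`measureEntropy_circleMul`), and one bit disappears in the rate. For any joining, the entropies of
the two marginals and of the image under addition therefore satisfy the triangle inequalities
(`measureEntropy_triangle`).

By compactness, a measure quasi-generated by `x + y`, or by `x`, lifts to one quasi-generated by the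
pair `(x, y)`. If `y` is deterministic, the points `x + y` and `x` thus realise the same set of
entropies (`image_entropy_add_deterministic`). Everything else depends only on that set: determinism
asks that it be `{0}`, and normality that it contain no value below `log₂ r`, because Lebesgue
measure is the only invariant measure with that much entropy (`mem_circleNormal_iff`).

For real numbers, the map from digit sequences to the circle also loses at most one bit per block,
so the same set of entropies is seen symbolically (`image_entropy_digitAlias`). -/

namespace NormDet

/-! ### Inequalities for `-p log p` -/

section GibbsInequality

/-- This is `log t ≤ t - 1` at `t = q / p`. Summed over two probability vectors, the corrections `q
- p` cancel and Gibbs' inequality results. -/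
lemma negMulLog_le_cross {p q : ℝ} (hp : 0 ≤ p) (hq : 0 ≤ q) (hpq : q = 0 → p = 0) :
    Real.negMulLog p ≤ -p * Real.log q + (q - p) := by
  rcases hp.eq_or_lt with rfl | hp
  · simpa using hq
  have hq' : 0 < q := hq.lt_of_ne fun h => hp.ne' (hpq h.symm)
  have h := Real.log_le_sub_one_of_pos (div_pos hq' hp)
  rw [Real.log_div hq'.ne' hp.ne'] at h
  have := mul_le_mul_of_nonneg_left h hp.le
  have e : p * (q / p - 1) = q - p := by field_simp
  rw [e] at this
  unfold Real.negMulLog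
  linarith

/-- The inequality `log t < t - 1` is strict away from `t = 1`. This equality case later singles out
Lebesgue measure. -/
lemma eq_of_cross_le_negMulLog {p q : ℝ} (hp : 0 ≤ p) (hq : 0 < q)
    (h : -p * Real.log q + (q - p) ≤ Real.negMulLog p) : p = q := by
  rcases hp.eq_or_lt with rfl | hp
  · simp at h; linarith
  by_contra hne
  have h' := Real.log_lt_sub_one_of_pos (div_pos hq hp)
    (fun h => hne ((div_eq_one_iff_eq hp.ne').1 h).symm)
  rw [Real.log_div hq.ne' hp.ne'] at h'
  have := mul_lt_mul_of_pos_left h' hp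
  have e : p * (q / p - 1) = q - p := by field_simp
  rw [e] at this
  unfold Real.negMulLog at h
  linarith

lemma negMulLog_sum_le {ι : Type*} (s : Finset ι) (p : ι → ℝ) (hp : ∀ i, 0 ≤ p i) :
    Real.negMulLog (∑ i ∈ s, p i) ≤ ∑ i ∈ s, Real.negMulLog (p i) := by
  have h : Real.negMulLog (∑ i ∈ s, p i) = ∑ i ∈ s, -p i * Real.log (∑ j ∈ s, p j) := by
    rw [← Finset.sum_mul, Finset.sum_neg_distrib]; rfl
  rw [h]
  refine Finset.sum_le_sum fun i hi => ?_
  rcases (hp i).eq_or_lt with h0 | h0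
  · simp [← h0]
  · unfold Real.negMulLog
    have : Real.log (p i) ≤ Real.log (∑ j ∈ s, p j) :=
      Real.log_le_log h0 (Finset.single_le_sum (fun j _ => hp j) hi)
    nlinarith

/-- Gibbs' inequality against the product of the two marginals, whose logarithm splits into a sum.
-/
lemma sum_negMulLog_prod_le {ι κ : Type*} [Fintype ι] [Fintype κ] (p : ι × κ → ℝ)
    (hp : ∀ i, 0 ≤ p i) (h1 : ∑ i, p i = 1) :
    ∑ i, Real.negMulLog (p i) ≤ ∑ a, Real.negMulLog (∑ b, p (a, b)) +
      ∑ b, Real.negMulLog (∑ a, p (a, b)) := by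
  set u : ι → ℝ := fun a => ∑ b, p (a, b) with hu
  set v : κ → ℝ := fun b => ∑ a, p (a, b) with hv
  have hu0 : ∀ a, 0 ≤ u a := fun a => Finset.sum_nonneg fun _ _ => hp _
  have hv0 : ∀ b, 0 ≤ v b := fun b => Finset.sum_nonneg fun _ _ => hp _
  have pu : ∀ a b, p (a, b) ≤ u a := fun a b =>
    Finset.single_le_sum (f := fun b => p (a, b)) (fun _ _ => hp _) (Finset.mem_univ b)
  have pv : ∀ a b, p (a, b) ≤ v b := fun a b =>
    Finset.single_le_sum (f := fun a => p (a, b)) (fun _ _ => hp _) (Finset.mem_univ a)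
  have key : ∀ i : ι × κ, Real.negMulLog (p i) ≤
      -p i * Real.log (u i.1) + -p i * Real.log (v i.2) + (u i.1 * v i.2 - p i) := by
    rintro ⟨a, b⟩
    rcases (hp (a, b)).eq_or_lt with h0 | h0
    · simp only [← h0]
      simpa using mul_nonneg (hu0 a) (hv0 b)
    have hua := h0.trans_le (pu a b)
    have hvb := h0.trans_le (pv a b)
    have := negMulLog_le_cross h0.le (mul_pos hua hvb).le
      (fun h => absurd h (mul_pos hua hvb).ne')
    rw [Real.log_mul hua.ne' hvb.ne'] at this
    linarith
  have su : ∑ a, u a = 1 := by rw [← h1, Fintype.sum_prod_type]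
  have sv : ∑ b, v b = 1 := by rw [← h1, Fintype.sum_prod_type_right]
  calc ∑ i, Real.negMulLog (p i) ≤ _ := Finset.sum_le_sum fun i _ => key i
    _ = _ := by
      rw [Finset.sum_add_distrib, Finset.sum_add_distrib, Finset.sum_sub_distrib, h1,
        Fintype.sum_prod_type (f := fun i : ι × κ => u i.1 * v i.2),
        ← Finset.sum_mul_sum, su, sv, Fintype.sum_prod_type,
        Fintype.sum_prod_type_right (f := fun i : ι × κ => -p i * Real.log (v i.2))]
      simp only [← Finset.sum_mul, Finset.sum_neg_distrib]
      simp [Real.negMulLog, hu, hv]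

end GibbsInequality

/-! ### Shannon entropy of finite partitions -/

section Shannon

variable {X : Type*} [MeasurableSpace X] {Y : Type*} [MeasurableSpace Y]

/-- A labelling of `X` all of whose fibres (and unions of fibres) are measurable. -/
def IsPartition {ι : Type*} (P : X → ι) : Prop := ∀ s : Set ι, MeasurableSet (P ⁻¹' s)

variable {ι κ ρ : Type*}

lemma IsPartition.comp {P : X → ι} (hP : IsPartition P) (g : ι → κ) :
    IsPartition (fun x => g (P x)) := fun s => hP (g ⁻¹' s)

lemma IsPartition.comp_measurable {P : Y → ι} (hP : IsPartition P) {f : X → Y}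
    (hf : Measurable f) : IsPartition (fun x => P (f x)) := fun s => hf (hP s)

lemma isPartition_of_singleton [Countable ι] {P : X → ι}
    (h : ∀ a, MeasurableSet (P ⁻¹' {a})) : IsPartition P := fun s => by
  have : P ⁻¹' s = ⋃ a ∈ s, P ⁻¹' {a} := by ext; simp
  rw [this]
  exact MeasurableSet.biUnion s.to_countable fun a _ => h a

lemma isPartition_of_measurable [MeasurableSpace ι] [DiscreteMeasurableSpace ι] {P : X → ι}
    (h : Measurable P) : IsPartition P := fun _ => h MeasurableSet.of_discrete

lemma IsPartition.prodMk [Countable ι] [Countable κ] {P : X → ι} {Q : X → κ}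
    (hP : IsPartition P) (hQ : IsPartition Q) : IsPartition (fun x => (P x, Q x)) :=
  isPartition_of_singleton fun ⟨a, b⟩ => by
    have : (fun x => (P x, Q x)) ⁻¹' {(a, b)} = P ⁻¹' {a} ∩ Q ⁻¹' {b} := by ext; simp
    rw [this]
    exact (hP _).inter (hQ _)

lemma IsPartition.iteratedPartition [Finite ι] {P : X → ι} (hP : IsPartition P) {T : X → X}
    (hT : Measurable T) (n : ℕ) : IsPartition (iteratedPartition T P n) :=
  isPartition_of_singleton fun B => by
    have : NormDet.iteratedPartition T P n ⁻¹' {B} = ⋂ i : Fin n, T^[i] ⁻¹' (P ⁻¹' {B i}) := by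
      ext; simp [NormDet.iteratedPartition, funext_iff]
    rw [this]
    exact MeasurableSet.iInter fun i => (hT.iterate i) (hP _)

variable [Fintype ι]

lemma shannonEntropy_eq (μ : Measure X) (P : X → ι) :
    shannonEntropy μ P = (∑ a, Real.negMulLog (μ.real (P ⁻¹' {a}))) / Real.log 2 := by
  rw [shannonEntropy, Finset.sum_div]

lemma shannonEntropy_map (μ : Measure X) {f : X → Y} (hf : Measurable f) {P : Y → ι} (hP : IsPartition P) :
    shannonEntropy (μ.map f) P = shannonEntropy μ (fun x => P (f x)) := by
  unfold shannonEntropy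
  refine Finset.sum_congr rfl fun a _ => ?_
  rw [map_measureReal_apply hf (hP _)]; rfl

lemma measureReal_comp_fibre (μ : Measure X) [IsProbabilityMeasure μ] [DecidableEq κ] {P : X → ι} (hP : IsPartition P) (g : ι → κ) (b : κ) :
    μ.real ((fun x => g (P x)) ⁻¹' {b}) =
      ∑ a ∈ Finset.univ.filter (fun a => g a = b), μ.real (P ⁻¹' {a}) := by
  rw [← measureReal_biUnion_finset (fun a _ b _ hab =>
    Set.disjoint_left.2 fun x hx hy => hab (hx.symm.trans hy)) (fun a _ => hP _)]
  congr 1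
  ext; simp

variable [Fintype κ] [Fintype ρ] {μ : Measure X} [IsProbabilityMeasure μ]

lemma sum_measureReal_fibre {P : X → ι} (hP : IsPartition P) :
    ∑ a, μ.real (P ⁻¹' {a}) = 1 := by
  classical
  rw [← measureReal_biUnion_finset (fun a _ b _ hab =>
    Set.disjoint_left.2 fun x hx hy => hab (hx.symm.trans hy)) (fun a _ => hP _)]
  have : (⋃ a ∈ (Finset.univ : Finset ι), P ⁻¹' {a}) = Set.univ := by ext; simp
  rw [this]; simp

lemma shannonEntropy_nonneg (P : X → ι) : 0 ≤ shannonEntropy μ P :=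
  Finset.sum_nonneg fun _ _ => div_nonneg
    (Real.negMulLog_nonneg measureReal_nonneg measureReal_le_one) (Real.log_nonneg (by norm_num))

lemma shannonEntropy_comp_le {P : X → ι} (hP : IsPartition P) (g : ι → κ) :
    shannonEntropy μ (fun x => g (P x)) ≤ shannonEntropy μ P := by
  classical
  rw [shannonEntropy_eq, shannonEntropy_eq]
  refine div_le_div_of_nonneg_right ?_ (Real.log_nonneg (by norm_num))
  simp_rw [measureReal_comp_fibre μ hP g]
  rw [← Finset.sum_fiberwise (s := Finset.univ) (g := g)
    (f := fun a => Real.negMulLog (μ.real (P ⁻¹' {a})))]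
  exact Finset.sum_le_sum fun b _ => negMulLog_sum_le _ _ fun _ => measureReal_nonneg

lemma shannonEntropy_le_of_factor {P : X → ι} (hP : IsPartition P) {Q : X → κ} (g : ι → κ)
    (h : ∀ x, Q x = g (P x)) : shannonEntropy μ Q ≤ shannonEntropy μ P := by
  rw [funext h]; exact shannonEntropy_comp_le hP g

lemma shannonEntropy_prodMk_le {P : X → ι} (hP : IsPartition P) {Q : X → κ} (hQ : IsPartition Q) :
    shannonEntropy μ (fun x => (P x, Q x)) ≤ shannonEntropy μ P + shannonEntropy μ Q := by
  classical
  have hPQ := hP.prodMk hQ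
  rw [shannonEntropy_eq, shannonEntropy_eq, shannonEntropy_eq, ← add_div]
  refine div_le_div_of_nonneg_right ?_ (Real.log_nonneg (by norm_num))
  refine (sum_negMulLog_prod_le _ (fun _ => measureReal_nonneg)
    (sum_measureReal_fibre (μ := μ) hPQ)).trans_eq ?_
  congr 1
  · refine Finset.sum_congr rfl fun a _ => ?_
    congr 1
    rw [← measureReal_biUnion_finset (fun b _ c _ hbc =>
      Set.disjoint_left.2 fun x hx hy => hbc (Prod.ext_iff.1 (hx.symm.trans hy)).2)
      (fun b _ => hPQ _)]
    congr 1
    ext; simp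
  · refine Finset.sum_congr rfl fun a _ => ?_
    congr 1
    rw [← measureReal_biUnion_finset (fun b _ c _ hbc =>
      Set.disjoint_left.2 fun x hx hy => hbc (Prod.ext_iff.1 (hx.symm.trans hy)).1)
      (fun b _ => hPQ _)]
    congr 1
    ext; simp

lemma shannonEntropy_le_of_factor₂ {P : X → ι} (hP : IsPartition P) {Q : X → κ}
    (hQ : IsPartition Q) {R : X → ρ} (g : ι → κ → ρ) (h : ∀ x, R x = g (P x) (Q x)) :
    shannonEntropy μ R ≤ shannonEntropy μ P + shannonEntropy μ Q :=
  (shannonEntropy_le_of_factor (hP.prodMk hQ) (fun c => g c.1 c.2) h).trans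
    (shannonEntropy_prodMk_le hP hQ)

/-- Gibbs' inequality against the uniform distribution. -/
lemma shannonEntropy_le_log_card {P : X → ι} (hP : IsPartition P) :
    shannonEntropy μ P ≤ Real.log (Fintype.card ι) / Real.log 2 := by
  rw [shannonEntropy_eq]
  refine div_le_div_of_nonneg_right ?_ (Real.log_nonneg (by norm_num))
  have hs := sum_measureReal_fibre (μ := μ) hP
  have hc : (0 : ℝ) < Fintype.card ι := by
    rw [Nat.cast_pos, Fintype.card_pos_iff]
    by_contra h
    rw [not_nonempty_iff] at h
    simp at hs
  have key : ∀ a ∈ (Finset.univ : Finset ι), _ := fun a _ =>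
    negMulLog_le_cross (p := μ.real (P ⁻¹' {a})) measureReal_nonneg (inv_pos.2 hc).le
      (fun h => absurd h (inv_pos.2 hc).ne')
  refine (Finset.sum_le_sum key).trans_eq ?_
  rw [Finset.sum_add_distrib, ← Finset.sum_mul, Finset.sum_neg_distrib, Finset.sum_sub_distrib, hs]
  simp [hc.ne']

/-- If the sum attains its bound, so does each term of Gibbs' inequality, and the equality case
applies atom by atom. -/
lemma measureReal_fibre_eq_of_log_card_le {P : X → ι} (hP : IsPartition P)
    (h : Real.log (Fintype.card ι) / Real.log 2 ≤ shannonEntropy μ P) (a : ι) :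
    μ.real (P ⁻¹' {a}) = (Fintype.card ι : ℝ)⁻¹ := by
  rw [shannonEntropy_eq, div_le_div_iff_of_pos_right (Real.log_pos (by norm_num))] at h
  have hs := sum_measureReal_fibre (μ := μ) hP
  have hc : (0 : ℝ) < Fintype.card ι := by
    rw [Nat.cast_pos, Fintype.card_pos_iff]; exact ⟨a⟩
  have key : ∀ a ∈ (Finset.univ : Finset ι), _ := fun a _ =>
    negMulLog_le_cross (p := μ.real (P ⁻¹' {a})) measureReal_nonneg (inv_pos.2 hc).le
      (fun h => absurd h (inv_pos.2 hc).ne')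
  have e : ∑ a, (-μ.real (P ⁻¹' {a}) * Real.log (Fintype.card ι : ℝ)⁻¹ +
      ((Fintype.card ι : ℝ)⁻¹ - μ.real (P ⁻¹' {a}))) = Real.log (Fintype.card ι) := by
    rw [Finset.sum_add_distrib, ← Finset.sum_mul, Finset.sum_neg_distrib,
      Finset.sum_sub_distrib, hs]
    simp [hc.ne']
  have heq := (Finset.sum_eq_sum_iff_of_le key).1
    (le_antisymm (Finset.sum_le_sum key) (e.trans_le h)) a (Finset.mem_univ a)
  exact eq_of_cross_le_negMulLog measureReal_nonneg (inv_pos.2 hc) heq.ge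

/-- A partition that is determined by `Q` up to two choices has at most one more bit of entropy. -/
lemma shannonEntropy_le_add_one {P : X → ι} (hP : IsPartition P) {Q : X → κ} (hQ : IsPartition Q)
    (g₀ g₁ : κ → ι) (h : ∀ x, P x = g₀ (Q x) ∨ P x = g₁ (Q x)) :
    shannonEntropy μ P ≤ shannonEntropy μ Q + 1 := by
  classical
  -- The extra bit records whether the first choice is the right one.
  have hS : IsPartition (fun x => decide (P x = g₀ (Q x))) :=
    (hP.prodMk hQ).comp fun c => decide (c.1 = g₀ c.2)
  refine (shannonEntropy_le_of_factor₂ hQ hS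
    (fun q s => if s then g₀ q else g₁ q) fun x => ?_).trans ?_
  · by_cases hx : P x = g₀ (Q x)
    · simp [hx]
    · simp only [hx, decide_false]
      simpa [hx] using h x
  · have := shannonEntropy_le_log_card (μ := μ) hS
    simp only [Fintype.card_bool, Nat.cast_ofNat] at this
    rw [div_self (Real.log_pos (by norm_num)).ne'] at this
    linarith

end Shannon

/-! ### Growth rates -/

section Rate

/-- The exponential growth rate of a sequence of entropies. -/
noncomputable def entropyRate (u : ℕ → ℝ) : ℝ≥0∞ :=
  limsup (fun n : ℕ => ENNReal.ofReal (u n / n)) atTop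

/-- The bounded error `d` vanishes after division by `n`; this is why a carry costs no entropy. -/
lemma entropyRate_le_add {u v w : ℕ → ℝ} {d : ℝ}
    (h : ∀ n, u n ≤ v n + w n + d) : entropyRate u ≤ entropyRate v + entropyRate w := by
  refine ENNReal.le_of_forall_pos_le_add fun ε hε hfin => ?_
  rw [ENNReal.add_lt_top] at hfin
  have hε3 : (0 : ℝ≥0∞) < ε / 3 := ENNReal.div_pos (by simpa using hε.ne') (by norm_num)
  have hv := eventually_lt_of_limsup_lt
    (ENNReal.lt_add_right (a := entropyRate v) hfin.1.ne hε3.ne')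
  have hw := eventually_lt_of_limsup_lt
    (ENNReal.lt_add_right (a := entropyRate w) hfin.2.ne hε3.ne')
  have hd : Tendsto (fun n : ℕ => ENNReal.ofReal (d / n)) atTop (𝓝 0) := by
    have := ENNReal.tendsto_ofReal (tendsto_const_div_atTop_nhds_zero_nat d)
    simpa using this
  have hd := hd.eventually (gt_mem_nhds hε3)
  refine limsup_le_of_le (by isBoundedDefault) ?_
  filter_upwards [hv, hw, hd] with n h1 h2 h3
  have : u n / n ≤ v n / n + w n / n + d / n := by
    rw [← add_div, ← add_div]
    exact div_le_div_of_nonneg_right (h n) (Nat.cast_nonneg n)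
  calc ENNReal.ofReal (u n / n)
      ≤ ENNReal.ofReal (v n / n) + ENNReal.ofReal (w n / n) + ENNReal.ofReal (d / n) :=
        (ENNReal.ofReal_le_ofReal this).trans (ENNReal.ofReal_add_le.trans
          (add_le_add_left ENNReal.ofReal_add_le _))
    _ ≤ (entropyRate v + ε / 3) + (entropyRate w + ε / 3) + ε / 3 :=
        add_le_add (add_le_add h1.le h2.le) h3.le
    _ = entropyRate v + entropyRate w + (ε / 3 + ε / 3 + ε / 3) := by ring
    _ = _ := by rw [ENNReal.add_thirds]

lemma entropyRate_mul_nat (c : ℝ) : entropyRate (fun n => n * c) = ENNReal.ofReal c := by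
  refine Tendsto.limsup_eq (tendsto_const_nhds.congr' ?_)
  filter_upwards [eventually_gt_atTop 0] with n hn
  have : (n : ℝ) ≠ 0 := by positivity
  field_simp

lemma entropyRate_le_add_const {u v : ℕ → ℝ} {d : ℝ} (c : ℝ)
    (h : ∀ n, u n ≤ v n + n * c + d) : entropyRate u ≤ entropyRate v + ENNReal.ofReal c := by
  rw [← entropyRate_mul_nat c]; exact entropyRate_le_add h

lemma entropyRate_le {u v : ℕ → ℝ} {d : ℝ}
    (h : ∀ n, u n ≤ v n + d) : entropyRate u ≤ entropyRate v := by
  simpa using entropyRate_le_add_const (u := u) (v := v) (d := d) 0 (by simpa using h)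

end Rate

/-! ### Entropy of invariant measures and generators -/

section Dynamics

variable {X : Type*} [MeasurableSpace X] {ι κ : Type*} [Fintype ι] [Fintype κ]
  {T : X → X} {μ : Measure X} [IsProbabilityMeasure μ]

/-- An itinerary of length `m + n` is one of length `m` followed by one of length `n` read from
`T^[m] x`, which has the same law by invariance. -/
lemma shannonEntropy_iteratedPartition_add_le (hT : MeasurePreserving T μ μ) {P : X → ι}
    (hP : IsPartition P) (m n : ℕ) :
    shannonEntropy μ (iteratedPartition T P (m + n)) ≤
      shannonEntropy μ (iteratedPartition T P m) + shannonEntropy μ (iteratedPartition T P n) := by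
  have hTm := hT.iterate m
  have hPn := hP.iteratedPartition hT.measurable n
  have e : shannonEntropy μ (iteratedPartition T P n) =
      shannonEntropy μ (fun x => iteratedPartition T P n (T^[m] x)) := by
    rw [← shannonEntropy_map μ hTm.measurable hPn, hTm.map_eq]
  rw [e]
  refine shannonEntropy_le_of_factor₂ (hP.iteratedPartition hT.measurable m)
    (hPn.comp_measurable hTm.measurable) (fun a b => Fin.append a b) fun x => ?_
  funext i
  refine Fin.addCases (fun i => ?_) (fun i => ?_) i
  · simp [iteratedPartition]
  · simp [iteratedPartition, add_comm m, Function.iterate_add_apply]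

/-- By Fekete's lemma the limit defining the entropy is also an infimum. -/
lemma partitionEntropy_le_div (hT : MeasurePreserving T μ μ) {P : X → ι}
    (hP : IsPartition P) {n : ℕ} (hn : n ≠ 0) :
    partitionEntropy μ T P ≤ ENNReal.ofReal (shannonEntropy μ (iteratedPartition T P n) / n) := by
  have hsub : Subadditive fun n => shannonEntropy μ (iteratedPartition T P n) :=
    shannonEntropy_iteratedPartition_add_le hT hP
  have hb : BddBelow (Set.range fun n : ℕ => shannonEntropy μ (iteratedPartition T P n) / n) := by
    refine ⟨0, ?_⟩
    rintro _ ⟨n, rfl⟩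
    exact div_nonneg (shannonEntropy_nonneg _) (Nat.cast_nonneg n)
  have := (ENNReal.tendsto_ofReal (hsub.tendsto_lim hb)).limsup_eq
  exact this.trans_le (ENNReal.ofReal_le_ofReal (hsub.lim_le_div hb hn))

lemma partitionEntropy_le_shannonEntropy (hT : MeasurePreserving T μ μ) {P : X → ι}
    (hP : IsPartition P) : partitionEntropy μ T P ≤ ENNReal.ofReal (shannonEntropy μ P) := by
  refine (partitionEntropy_le_div hT hP one_ne_zero).trans (ENNReal.ofReal_le_ofReal ?_)
  rw [Nat.cast_one, div_one]
  exact shannonEntropy_le_of_factor hP (fun a _ => a) fun x => funext fun i => by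
    simp [iteratedPartition, Subsingleton.elim i 0]

lemma partitionEntropy_comp_le (hT : Measurable T) {P : X → ι} (hP : IsPartition P) (g : ι → κ) :
    partitionEntropy μ T (fun x => g (P x)) ≤ partitionEntropy μ T P :=
  entropyRate_le (d := 0) fun n => by
    rw [add_zero]
    exact shannonEntropy_le_of_factor (hP.iteratedPartition hT n) (fun a i => g (a i))
      fun x => rfl

lemma partitionEntropy_le_measureEntropy (hT : Measurable T) {P : X → ι} (hP : IsPartition P) :
    partitionEntropy μ T P ≤ measureEntropy μ T := by
  have e := Fintype.equivFin ι
  have h1 : partitionEntropy μ T P ≤ partitionEntropy μ T (fun x => e (P x)) := by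
    simpa using partitionEntropy_comp_le (μ := μ) hT (hP.comp e) e.symm
  refine h1.trans (le_iSup₂_of_le (Fintype.card ι) (fun x => e (P x)) (le_iSup_of_le ?_ le_rfl))
  exact fun s _ => hP.comp e s

/-- The sets that are determined by finitely many coordinates of the itinerary. -/
def cylinderSets (T : X → X) (α : X → ι) : Set (Set X) :=
  {s | ∃ (n : ℕ) (F : Set (Fin n → ι)), s = iteratedPartition T α n ⁻¹' F}

/-- `α` generates: the itineraries determine the measurable structure. -/
structure IsGenerator (T : X → X) (α : X → ι) : Prop where
  isPartition : IsPartition α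
  le_generateFrom : ‹MeasurableSpace X› ≤ MeasurableSpace.generateFrom (cylinderSets T α)

omit [MeasurableSpace X] [Fintype ι] in
lemma preimage_iteratedPartition_castLE {m n : ℕ} (h : m ≤ n) (T : X → X) (α : X → ι)
    (F : Set (Fin m → ι)) : iteratedPartition T α m ⁻¹' F =
      iteratedPartition T α n ⁻¹' ((fun a i => a (Fin.castLE h i)) ⁻¹' F) := rfl

omit [MeasurableSpace X] [Fintype ι] in
lemma isSetAlgebra_cylinderSets (T : X → X) (α : X → ι) : IsSetAlgebra (cylinderSets T α) where
  empty_mem := ⟨0, ∅, rfl⟩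
  compl_mem := by
    rintro _ ⟨n, F, rfl⟩
    exact ⟨n, Fᶜ, rfl⟩
  union_mem := by
    rintro _ _ ⟨m, F, rfl⟩ ⟨n, G, rfl⟩
    rw [preimage_iteratedPartition_castLE (le_max_left m n),
      preimage_iteratedPartition_castLE (le_max_right m n)]
    exact ⟨max m n, _, (Set.preimage_union).symm⟩

lemma IsGenerator.eq_generateFrom {α : X → ι} (hα : IsGenerator T α) (hT : Measurable T) :
    ‹MeasurableSpace X› = MeasurableSpace.generateFrom (cylinderSets T α) := by
  refine le_antisymm hα.le_generateFrom (MeasurableSpace.generateFrom_le ?_)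
  rintro _ ⟨n, F, rfl⟩
  exact hα.isPartition.iteratedPartition hT n F

/-- The cylinders form an algebra that generates the σ-algebra, so each atom of `P` is within `δ /
k` of a cylinder set; these sets are then brought to a common length. -/
lemma IsGenerator.exists_approx {α : X → ι} (hα : IsGenerator T α) (hT : Measurable T)
    {k : ℕ} {P : X → Fin k} (hP : IsPartition P) {δ : ℝ} (hδ : 0 < δ) :
    ∃ (m : ℕ) (g : (Fin m → ι) → Fin k),
      μ.real {x | P x ≠ g (iteratedPartition T α m x)} ≤ δ := by
  classical
  obtain ⟨x₀⟩ : Nonempty X := nonempty_of_isProbabilityMeasure μ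
  have hk : (0 : ℝ) < k := Nat.cast_pos.2 (P x₀).pos
  have hd := Measure.MeasureDense.of_generateFrom_isSetAlgebra_finite μ
    (isSetAlgebra_cylinderSets T α) (hα.eq_generateFrom hT)
  have happ : ∀ j : Fin k, ∃ (m : ℕ) (F : Set (Fin m → ι)),
      μ.real (symmDiff (P ⁻¹' {j}) (iteratedPartition T α m ⁻¹' F)) ≤ δ / k := fun j => by
    obtain ⟨_, ⟨m, F, rfl⟩, h⟩ := hd.approx _ (hP {j}) (measure_ne_top _ _) (δ / k) (by positivity)
    exact ⟨m, F, ENNReal.toReal_le_of_le_ofReal (by positivity) h.le⟩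
  choose m F hF using happ
  let M := Finset.univ.sup m
  have hM : ∀ j, m j ≤ M := fun j => Finset.le_sup (Finset.mem_univ j)
  let G : Fin k → Set (Fin M → ι) := fun j => (fun a i => a (Fin.castLE (hM j) i)) ⁻¹' F j
  have hG : ∀ j, iteratedPartition T α (m j) ⁻¹' F j = iteratedPartition T α M ⁻¹' G j :=
    fun j => preimage_iteratedPartition_castLE (hM j) T α (F j)
  -- Off the symmetric differences exactly one `G j` contains the itinerary, so neither the choice
  -- nor the default `P x₀` matters there.
  let g : (Fin M → ι) → Fin k := fun a => if h : ∃ j, a ∈ G j then h.choose else P x₀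
  refine ⟨M, g, ?_⟩
  have hsub : {x | P x ≠ g (iteratedPartition T α M x)} ⊆
      ⋃ j ∈ (Finset.univ : Finset (Fin k)),
        symmDiff (P ⁻¹' {j}) (iteratedPartition T α (m j) ⁻¹' F j) := by
    intro x hx
    by_contra hcon
    have hmem : ∀ j, P x = j ↔ iteratedPartition T α M x ∈ G j := fun j => by
      have : x ∉ symmDiff (P ⁻¹' {j}) (iteratedPartition T α M ⁻¹' G j) := fun h => hcon (by
        simp only [Finset.mem_univ, Set.iUnion_true, Set.mem_iUnion]
        exact ⟨j, by rw [hG]; exact h⟩)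
      rw [Set.mem_symmDiff] at this
      simp only [Set.mem_preimage, Set.mem_singleton_iff] at this
      tauto
    have hex : ∃ j, iteratedPartition T α M x ∈ G j := ⟨_, (hmem _).1 rfl⟩
    apply hx
    change P x = if h : ∃ j, iteratedPartition T α M x ∈ G j then h.choose else P x₀
    rw [dif_pos hex]
    exact (hmem _).2 hex.choose_spec
  calc μ.real {x | P x ≠ g (iteratedPartition T α M x)}
      ≤ _ := measureReal_mono hsub (measure_ne_top _ _)
    _ ≤ _ := measureReal_biUnion_finset_le _ _
    _ ≤ ∑ _j : Fin k, δ / k := Finset.sum_le_sum fun j _ => hF j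
    _ = δ := by simp; field_simp

omit [IsProbabilityMeasure μ] in
-- By continuity of `-p log p` at `0` and `1`, where it vanishes, a partition with almost all its
-- mass in one atom has little entropy. It will encode the errors of an approximation.
lemma exists_shannonEntropy_option_le (κ : Type*) [Fintype κ] {ε : ℝ} (hε : 0 < ε) :
    ∃ δ > 0, ∀ (μ : Measure X) [IsProbabilityMeasure μ] (S : X → Option κ), IsPartition S →
      μ.real {x | S x ≠ none} ≤ δ → shannonEntropy μ S ≤ ε := by
  have hl : (0 : ℝ) < Real.log 2 := Real.log_pos (by norm_num)
  -- The allowance `ε` is shared equally by the `card κ + 1` atoms.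
  set ε' : ℝ := ε * Real.log 2 / (Fintype.card κ + 1) with hε'
  have hε'0 : 0 < ε' := by positivity
  obtain ⟨δ₀, hδ₀, h0⟩ := Metric.continuousAt_iff.1
    (Real.continuous_negMulLog.continuousAt (x := 0)) ε' hε'0
  obtain ⟨δ₁, hδ₁, h1⟩ := Metric.continuousAt_iff.1
    (Real.continuous_negMulLog.continuousAt (x := 1)) ε' hε'0
  refine ⟨min δ₀ δ₁ / 2, by positivity, fun μ _ S hS hμ => ?_⟩
  have hmin : min δ₀ δ₁ / 2 < min δ₀ δ₁ := half_lt_self (by positivity)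
  have hnone : Real.negMulLog (μ.real (S ⁻¹' {none})) ≤ ε' := by
    have hc : μ.real (S ⁻¹' {none}) = 1 - μ.real {x | S x ≠ none} := by
      have := probReal_compl_eq_one_sub (μ := μ) (hS {none}ᶜ)
      rw [← Set.preimage_compl, compl_compl] at this
      exact this
    have := h1 (x := μ.real (S ⁻¹' {none})) (by
      rw [hc, Real.dist_eq, sub_sub_cancel_left, abs_neg, abs_of_nonneg measureReal_nonneg]
      exact hμ.trans_lt (hmin.trans_le (min_le_right _ _)))
    rw [Real.negMulLog_one, Real.dist_eq, sub_zero] at this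
    exact (le_abs_self _).trans this.le
  have hsome : ∀ j, Real.negMulLog (μ.real (S ⁻¹' {some j})) ≤ ε' := fun j => by
    have hle : μ.real (S ⁻¹' {some j}) ≤ μ.real {x | S x ≠ none} :=
      measureReal_mono (fun x (hx : S x = some j) => by simp [hx]) (measure_ne_top _ _)
    have := h0 (x := μ.real (S ⁻¹' {some j})) (by
      rw [Real.dist_eq, sub_zero, abs_of_nonneg measureReal_nonneg]
      exact (hle.trans hμ).trans_lt (hmin.trans_le (min_le_left _ _)))
    rw [Real.negMulLog_zero, Real.dist_eq, sub_zero] at this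
    exact (le_abs_self _).trans this.le
  rw [shannonEntropy_eq, div_le_iff₀ hl, Fintype.sum_option]
  calc _ ≤ ε' + ∑ _j : κ, ε' := add_le_add hnone (Finset.sum_le_sum fun j _ => hsome j)
    _ = ε * Real.log 2 := by
      simp only [Finset.sum_const, Finset.card_univ, nsmul_eq_mul, hε']
      field_simp
      ring

/-- The Kolmogorov–Sinai theorem on generators. -/
theorem IsGenerator.measureEntropy_eq {α : X → ι} (hα : IsGenerator T α)
    (hT : MeasurePreserving T μ μ) : measureEntropy μ T = partitionEntropy μ T α := by
  classical
  refine le_antisymm ?_ (partitionEntropy_le_measureEntropy hT.measurable hα.isPartition)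
  refine iSup₂_le fun k P => iSup_le fun hPm => ?_
  have hP := isPartition_of_measurable hPm
  refine ENNReal.le_of_forall_pos_le_add fun ε hε _ => ?_
  obtain ⟨δ, hδ, hS⟩ := exists_shannonEntropy_option_le (X := X) (Fin k) (NNReal.coe_pos.2 hε)
  obtain ⟨m, g, hg⟩ := hα.exists_approx (μ := μ) hT.measurable hP hδ
  have hαm := hα.isPartition.iteratedPartition hT.measurable m
  have hQ : IsPartition (fun x => g (iteratedPartition T α m x)) := hαm.comp g
  -- `S` is the correction: it is silent where the approximation is right and gives the true label
  -- elsewhere, so `P` is recovered from the approximation and `S`.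
  let S : X → Option (Fin k) :=
    fun x => if P x = g (iteratedPartition T α m x) then none else some (P x)
  have hSp : IsPartition S :=
    (hP.prodMk hQ).comp fun c => if c.1 = c.2 then none else some c.1
  have hSe : shannonEntropy μ S ≤ ε := hS μ S hSp (by
    convert hg using 5
    simp [S])
  have h1 : partitionEntropy μ T P ≤ partitionEntropy μ T (fun x => g (iteratedPartition T α m x))
      + partitionEntropy μ T S := by
    refine entropyRate_le_add (d := 0) fun n => ?_
    rw [add_zero]
    refine shannonEntropy_le_of_factor₂ (hQ.iteratedPartition hT.measurable n)
      (hSp.iteratedPartition hT.measurable n) (fun q s i => (s i).getD (q i)) fun x => ?_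
    funext i
    simp only [iteratedPartition, S]
    split_ifs with h
    · exact h
    · rfl
  have h2 : partitionEntropy μ T (fun x => g (iteratedPartition T α m x)) ≤
      partitionEntropy μ T α := by
    refine (partitionEntropy_comp_le hT.measurable hαm g).trans ?_
    -- An itinerary of length `n` for `m`-blocks is read off from `n + m` symbols, and the extra `m`
    -- symbols cost a bounded amount.
    refine entropyRate_le (d := shannonEntropy μ (iteratedPartition T α m)) fun n => ?_
    refine le_trans ?_ (shannonEntropy_iteratedPartition_add_le hT hα.isPartition n m)
    refine shannonEntropy_le_of_factor (hα.isPartition.iteratedPartition hT.measurable (n + m))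
      (fun a i j => a ⟨i + j, by omega⟩) fun x => ?_
    funext i j
    simp [iteratedPartition, ← Function.iterate_add_apply, add_comm]
  refine h1.trans (add_le_add h2 ((partitionEntropy_le_shannonEntropy hT hSp).trans ?_))
  exact (ENNReal.ofReal_le_ofReal hSe).trans_eq (ENNReal.ofReal_coe_nnreal)

/-- A measure has the maximal entropy `log₂ r` if and only if all cylinders of a generator with
`r` atoms have the same mass. -/
theorem IsGenerator.log_le_measureEntropy_iff {α : X → ι} (hα : IsGenerator T α)
    (hT : MeasurePreserving T μ μ) :
    ENNReal.ofReal (Real.log (Fintype.card ι) / Real.log 2) ≤ measureEntropy μ T ↔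
      ∀ (n : ℕ) (B : Fin n → ι),
        μ.real (iteratedPartition T α n ⁻¹' {B}) = ((Fintype.card ι : ℝ) ^ n)⁻¹ := by
  constructor
  · intro h n B
    rw [hα.measureEntropy_eq hT] at h
    have hαn := hα.isPartition.iteratedPartition hT.measurable n
    classical
    have hc : (Fintype.card (Fin n → ι) : ℝ) = (Fintype.card ι : ℝ) ^ n := by simp
    rw [← hc]
    refine measureReal_fibre_eq_of_log_card_le hαn ?_ B
    rw [hc, Real.log_pow]
    rcases eq_or_ne n 0 with rfl | hn
    · simpa using shannonEntropy_nonneg _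
    -- The entropy is at most `H_n / n` for every `n`, so each `H_n` must already be maximal and its
    -- atoms equal.
    have h2 := h.trans (partitionEntropy_le_div hT hα.isPartition hn)
    rw [ENNReal.ofReal_le_ofReal_iff
      (div_nonneg (shannonEntropy_nonneg _) (Nat.cast_nonneg n)),
      le_div_iff₀ (by positivity)] at h2
    calc _ = _ := by ring
      _ ≤ _ := h2
  · intro h
    refine le_trans ?_ (partitionEntropy_le_measureEntropy hT.measurable hα.isPartition)
    rw [← entropyRate_mul_nat]
    refine entropyRate_le (d := 0) fun n => ?_
    rw [add_zero, shannonEntropy_eq]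
    simp_rw [h n]
    simp only [Finset.sum_const, Finset.card_univ, Fintype.card_fun, Fintype.card_fin,
      nsmul_eq_mul, Real.negMulLog, Real.log_inv, Real.log_pow]
    obtain ⟨x₀⟩ : Nonempty X := nonempty_of_isProbabilityMeasure μ
    have : (0 : ℝ) < Fintype.card ι := Nat.cast_pos.2 (Fintype.card_pos_iff.2 ⟨α x₀⟩)
    push_cast
    field_simp
    exact le_rfl

lemma IsGenerator.measure_ext {α : X → ι} (hα : IsGenerator T α) (hT : Measurable T)
    {ν : Measure X} [IsProbabilityMeasure ν]
    (h : ∀ (n : ℕ) (B : Fin n → ι), μ.real (iteratedPartition T α n ⁻¹' {B}) =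
      ν.real (iteratedPartition T α n ⁻¹' {B})) : μ = ν := by
  classical
  refine ext_of_generate_finite _ (hα.eq_generateFrom hT)
    (isSetAlgebra_cylinderSets T α).isSetRing.isSetSemiring.isPiSystem ?_ (by simp)
  rintro _ ⟨n, F, rfl⟩
  have hαn := hα.isPartition.iteratedPartition hT n
  have e : ∀ ρ : Measure X, [IsProbabilityMeasure ρ] → ρ.real (iteratedPartition T α n ⁻¹' F) =
      ∑ B ∈ Finset.univ.filter (· ∈ F), ρ.real (iteratedPartition T α n ⁻¹' {B}) := fun ρ _ => by
    have := measureReal_comp_fibre ρ hαn (fun B => decide (B ∈ F)) true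
    simp only [decide_eq_true_eq] at this
    rw [← this]
    congr 1
    ext; simp
  rw [← measureReal_eq_measureReal_iff, e μ, e ν]
  exact Finset.sum_congr rfl fun B _ => h n B

omit [IsProbabilityMeasure μ] [Fintype ι] [Fintype κ] in
lemma measureEntropy_map_le {Y : Type*} [MeasurableSpace Y] {S : Y → Y} {f : X → Y}
    (hf : Measurable f) (hS : Measurable S) (hfT : ∀ x, f (T x) = S (f x)) :
    measureEntropy (μ.map f) S ≤ measureEntropy μ T := by
  refine iSup₂_le fun k P => iSup_le fun hP => ?_
  refine le_iSup₂_of_le k (fun x => P (f x)) (le_iSup_of_le (hP.comp hf) (le_of_eq ?_))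
  unfold partitionEntropy
  congr 1
  funext n
  rw [shannonEntropy_map μ hf ((isPartition_of_measurable hP).iteratedPartition hS n)]
  congr 3
  funext x i
  have : Function.Semiconj f T S := hfT
  simp [iteratedPartition, (this.iterate_right i) x]

end Dynamics

/-! ### Empirical and quasi-generated measures -/

section Points

variable {X : Type*} [TopologicalSpace X] [MeasurableSpace X]
  {Y : Type*} [TopologicalSpace Y] [MeasurableSpace Y]

/-- The empirical measure `(1/n) ∑_{i < n} δ_{Tⁱ x}`. -/
noncomputable def empiricalMeasure (T : X → X) (x : X) (n : ℕ) : Measure X :=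
  (n : ℝ≥0∞)⁻¹ • ∑ i ∈ Finset.range n, Measure.dirac (T^[i] x)

omit [TopologicalSpace X] in
lemma isProbabilityMeasure_empiricalMeasure (T : X → X) (x : X) {n : ℕ} (hn : n ≠ 0) :
    IsProbabilityMeasure (empiricalMeasure T x n) where
  measure_univ := by
    simp [empiricalMeasure, ENNReal.inv_mul_cancel, hn]

lemma integral_empiricalMeasure [BorelSpace X] [CompactSpace X] (T : X → X) (x : X) (n : ℕ)
    (f : C(X, ℝ)) : ∫ z, f z ∂(empiricalMeasure T x n) = birkhoffAverage ℝ T f n x := by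
  have hf : StronglyMeasurable f :=
    f.continuous.stronglyMeasurable_of_hasCompactSupport (HasCompactSupport.of_compactSpace f)
  rw [empiricalMeasure, integral_smul_measure, integral_finsetSum_measure]
  · simp [birkhoffAverage, birkhoffSum, integral_dirac' _ _ hf]
  · intro i _
    exact (integrable_const ‖f‖).mono' hf.aestronglyMeasurable
      (Eventually.of_forall fun z => f.norm_coe_le_norm z)

lemma tendsto_probabilityMeasure_iff [BorelSpace X] [CompactSpace X] {p : ℕ → ProbabilityMeasure X}
    {μ : ProbabilityMeasure X} : Tendsto p atTop (𝓝 μ) ↔ ∀ f : C(X, ℝ),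
      Tendsto (fun k => ∫ z, f z ∂(p k : Measure X)) atTop (𝓝 (∫ z, f z ∂(μ : Measure X))) := by
  rw [ProbabilityMeasure.tendsto_iff_forall_integral_tendsto]
  exact ⟨fun h f => h (BoundedContinuousFunction.mkOfCompact f), fun h f => h f.toContinuousMap⟩

lemma GeneratesAlong.comp {T : X → X} {x : X} {J : ℕ → ℕ} {μ : ProbabilityMeasure X}
    (h : GeneratesAlong T x J μ) {φ : ℕ → ℕ} (hφ : StrictMono φ) :
    GeneratesAlong T x (J ∘ φ) μ := fun f => (h f).comp hφ.tendsto_atTop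

/-- The probability measures on a compact metrizable space are sequentially compact in the weak*
topology. -/
lemma exists_generatesAlong [BorelSpace X] [CompactSpace X] [TopologicalSpace.MetrizableSpace X]
    (T : X → X) (x : X) {J : ℕ → ℕ} (hJ : StrictMono J) :
    ∃ (φ : ℕ → ℕ) (μ : ProbabilityMeasure X), StrictMono φ ∧ GeneratesAlong T x (J ∘ φ) μ := by
  have hne : ∀ k, J (k + 1) ≠ 0 := fun k => (Nat.zero_le _).trans_lt (hJ k.lt_succ_self) |>.ne'
  -- The index is shifted because `J 0` may be `0`, where the empirical measure is not a probability
  -- measure.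
  let p : ℕ → ProbabilityMeasure X := fun k =>
    ⟨empiricalMeasure T x (J (k + 1)), isProbabilityMeasure_empiricalMeasure T x (hne k)⟩
  let _ := TopologicalSpace.metrizableSpaceMetric X
  obtain ⟨μ, ψ, hψ, hlim⟩ := CompactSpace.tendsto_subseq p
  refine ⟨fun k => ψ k + 1, μ, fun a b h => Nat.succ_lt_succ (hψ h), fun f => ?_⟩
  exact (tendsto_probabilityMeasure_iff.1 hlim f).congr fun k =>
    integral_empiricalMeasure T x _ f

lemma quasiGenerated_nonempty [BorelSpace X] [CompactSpace X]
    [TopologicalSpace.MetrizableSpace X] (T : X → X) (x : X) : (quasiGenerated T x).Nonempty := by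
  obtain ⟨φ, μ, hφ, h⟩ := exists_generatesAlong T x strictMono_id
  exact ⟨μ, φ, hφ, h⟩

lemma probabilityMeasure_ext [BorelSpace X] [CompactSpace X] [TopologicalSpace.MetrizableSpace X]
    {μ ν : ProbabilityMeasure X}
    (h : ∀ f : C(X, ℝ), ∫ z, f z ∂(μ : Measure X) = ∫ z, f z ∂(ν : Measure X)) : μ = ν := by
  let _ := TopologicalSpace.metrizableSpaceMetric X
  exact Subtype.ext (ext_of_forall_integral_eq_of_IsFiniteMeasure
    (μ := (μ : Measure X)) (ν := (ν : Measure X)) fun f => h f.toContinuousMap)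

lemma measurePreserving_of_quasiGenerated [BorelSpace X] [CompactSpace X]
    [TopologicalSpace.MetrizableSpace X] {T : X → X} (hT : Continuous T) {x : X}
    {μ : ProbabilityMeasure X} (h : μ ∈ quasiGenerated T x) :
    MeasurePreserving T (μ : Measure X) μ := by
  refine ⟨hT.measurable, ?_⟩
  obtain ⟨J, hJ, hgen⟩ := h
  have := probabilityMeasure_ext (μ := μ.map hT.measurable.aemeasurable) (ν := μ) fun f => by
    rw [ProbabilityMeasure.toMeasure_map, integral_map hT.measurable.aemeasurable
      (f.continuous.stronglyMeasurable_of_hasCompactSupport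
        (HasCompactSupport.of_compactSpace f)).aestronglyMeasurable]
    have h1 := hgen (f.comp ⟨T, hT⟩)
    -- The averages along the orbits of `x` and `T x` telescope: for bounded `f` their difference
    -- tends to zero.
    have h2 := (hgen f).add ((tendsto_birkhoffAverage_apply_sub_birkhoffAverage' ℝ (g := f)
      (isCompact_range f.continuous).isBounded T x).comp hJ.tendsto_atTop)
    rw [add_zero] at h2
    refine tendsto_nhds_unique h1 (h2.congr fun k => ?_)
    have e : ∀ n, birkhoffAverage ℝ T (f.comp ⟨T, hT⟩) n x = birkhoffAverage ℝ T f n (T x) :=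
      fun n => by
        simp [birkhoffAverage, birkhoffSum, ← Function.iterate_succ_apply',
          Function.iterate_succ_apply]
    rw [e]
    simp
  exact congrArg Subtype.val this

variable [BorelSpace X] [BorelSpace Y]

lemma GeneratesAlong.map {T : X → X} {S : Y → Y} {π : X → Y} (hπ : Continuous π)
    (hsemi : Function.Semiconj π T S) [CompactSpace Y] [TopologicalSpace.MetrizableSpace Y]
    {x : X} {J : ℕ → ℕ} {μ : ProbabilityMeasure X} (h : GeneratesAlong T x J μ) :
    GeneratesAlong S (π x) J (μ.map hπ.measurable.aemeasurable) := fun f => by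
  rw [ProbabilityMeasure.toMeasure_map, integral_map hπ.measurable.aemeasurable
    (f.continuous.stronglyMeasurable_of_hasCompactSupport
      (HasCompactSupport.of_compactSpace f)).aestronglyMeasurable]
  refine (h (f.comp ⟨π, hπ⟩)).congr fun k => ?_
  simp [birkhoffAverage, birkhoffSum, (hsemi.iterate_right _).eq]

lemma map_mem_quasiGenerated {T : X → X} {S : Y → Y} {π : X → Y} (hπ : Continuous π)
    (hsemi : Function.Semiconj π T S) [CompactSpace Y] [TopologicalSpace.MetrizableSpace Y]
    {x : X} {μ : ProbabilityMeasure X} (h : μ ∈ quasiGenerated T x) :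
    μ.map hπ.measurable.aemeasurable ∈ quasiGenerated S (π x) :=
  h.imp fun _ hJ => ⟨hJ.1, hJ.2.map hπ hsemi⟩

/-- Every measure quasi-generated by a factor point lifts. -/
lemma exists_lift_quasiGenerated {T : X → X} {S : Y → Y} {π : X → Y} (hπ : Continuous π)
    (hsemi : Function.Semiconj π T S) [CompactSpace Y] [TopologicalSpace.MetrizableSpace Y]
    [CompactSpace X] [TopologicalSpace.MetrizableSpace X]
    {x : X} {ν : ProbabilityMeasure Y} (h : ν ∈ quasiGenerated S (π x)) :
    ∃ μ ∈ quasiGenerated T x, μ.map hπ.measurable.aemeasurable = ν := by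
  obtain ⟨J, hJ, hgen⟩ := h
  obtain ⟨φ, μ, hφ, hμ⟩ := exists_generatesAlong T x hJ
  exact ⟨μ, ⟨_, hJ.comp hφ, hμ⟩, probabilityMeasure_ext fun f =>
    tendsto_nhds_unique (hμ.map hπ hsemi f) (hgen.comp hφ f)⟩

/-- If all quasi-generated measures have the same integral of `f`, the time averages converge. -/
lemma tendsto_birkhoffAverage_of_quasiGenerated [CompactSpace X]
    [TopologicalSpace.MetrizableSpace X] {T : X → X} {x : X} {f : C(X, ℝ)} {c : ℝ}
    (h : ∀ μ ∈ quasiGenerated T x, ∫ z, f z ∂(μ : Measure X) = c) :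
    Tendsto (fun n => birkhoffAverage ℝ T f n x) atTop (𝓝 c) := by
  refine tendsto_of_subseq_tendsto fun ns hns => ?_
  obtain ⟨ψ, -, hJ⟩ := strictMono_subseq_of_tendsto_atTop hns
  obtain ⟨φ, μ, hφ, hμ⟩ := exists_generatesAlong T x hJ
  refine ⟨ψ ∘ φ, ?_⟩
  rw [← h μ ⟨_, hJ.comp hφ, hμ⟩]
  exact hμ f

lemma IsGeneric.eq_of_mem_quasiGenerated [CompactSpace X] [TopologicalSpace.MetrizableSpace X]
    {T : X → X} {x : X} {μ ν : ProbabilityMeasure X} (hμ : IsGeneric T x μ)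
    (hν : ν ∈ quasiGenerated T x) : ν = μ := by
  obtain ⟨J, hJ, h⟩ := hν
  exact probabilityMeasure_ext fun f => tendsto_nhds_unique (h f) ((hμ.comp hJ) f)

lemma isGeneric_iff [CompactSpace X] [TopologicalSpace.MetrizableSpace X]
    {T : X → X} {x : X} {μ : ProbabilityMeasure X} :
    IsGeneric T x μ ↔ ∀ ν ∈ quasiGenerated T x, ν = μ :=
  ⟨fun h _ hν => h.eq_of_mem_quasiGenerated hν, fun h f =>
    tendsto_birkhoffAverage_of_quasiGenerated fun ν hν => by rw [h ν hν]⟩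

end Points

/-! ### Words as residues modulo `r ^ n` -/

section Words

variable {r : ℕ}

/-- The number, modulo `rⁿ`, that is written with the digits `B` in base `r`. -/
def wordValue {n : ℕ} (B : Fin n → Fin r) : ZMod (r ^ n) :=
  ((finFunctionFinEquiv fun i => B i.rev : Fin (r ^ n)) : ℕ)

lemma wordValue_injective {n : ℕ} :
    Function.Injective (wordValue : (Fin n → Fin r) → ZMod (r ^ n)) := by
  intro B C h
  unfold wordValue at h
  rw [ZMod.natCast_eq_natCast_iff] at h
  have h' := Fin.ext (Nat.ModEq.eq_of_lt_of_lt h (Fin.is_lt _) (Fin.is_lt _))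
  have h'' := finFunctionFinEquiv.injective h'
  funext i
  simpa using congrFun h'' i.rev

/-- `finFunctionFinEquiv` puts the least significant digit first, while expansions start with the
most significant one; hence the reversal. -/
lemma pow_mul_sum_ofDigitsTerm [NeZero r] (ω : ℕ → Fin r) (n : ℕ) :
    (r : ℝ) ^ n * ∑ i ∈ Finset.range n, Real.ofDigitsTerm ω i =
      ((finFunctionFinEquiv fun i : Fin n => ω i.rev : Fin (r ^ n)) : ℕ) := by
  have hr : (r : ℝ) ≠ 0 := Nat.cast_ne_zero.2 (NeZero.ne r)
  rw [finFunctionFinEquiv_apply, Finset.sum_range, Finset.mul_sum,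
    ← Equiv.sum_comp Fin.revPerm]
  push_cast
  refine Finset.sum_congr rfl fun i _ => ?_
  simp only [Real.ofDigitsTerm, Fin.revPerm_apply, Fin.val_rev]
  have e : n - (i + 1) + 1 + i = n := by omega
  have e' : (r : ℝ) ^ n = (r : ℝ) ^ (n - (i + 1) + 1) * (r : ℝ) ^ (i : ℕ) := by
    rw [← pow_add, e]
  rw [e']
  field_simp

lemma wordValue_eq_floor [NeZero r] (ω : ℕ → Fin r) (n : ℕ) :
    wordValue (fun i : Fin n => ω i) =
      (⌊(r : ℝ) ^ n * ∑ i ∈ Finset.range n, Real.ofDigitsTerm ω i⌋ : ℤ) := by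
  rw [pow_mul_sum_ofDigitsTerm, Int.floor_natCast, Int.cast_natCast]
  rfl

end Words

/-! ### Base `r` intervals and digits on the circle -/

section Circle

variable (r : ℕ)

/-- The representative of `t` in `[0, 1)`. -/
noncomputable def unitRep (t : UnitAddCircle) : ℝ := AddCircle.equivIco 1 0 t

lemma unitRep_coe (x : ℝ) : unitRep (x : UnitAddCircle) = Int.fract x := by
  have h := AddCircle.coe_equivIco_mk_apply (1 : ℝ) x
  rw [div_one, mul_one] at h
  exact h

lemma coe_unitRep (t : UnitAddCircle) : ((unitRep t : ℝ) : UnitAddCircle) = t :=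
  AddCircle.coe_equivIco

lemma measurable_unitRep : Measurable unitRep :=
  measurable_subtype_coe.comp (AddCircle.measurableEquivIco 1 0).measurable

/-- The index modulo `rⁿ` of the interval `[j / rⁿ, (j + 1) / rⁿ)` that contains `t`. -/
noncomputable def cell (n : ℕ) (t : UnitAddCircle) : ZMod (r ^ n) :=
  (⌊(r : ℝ) ^ n * unitRep t⌋ : ℤ)

/-- Since the index is taken modulo `r ^ n`, any real representative may be used, and no wrap-around
has to be treated in sums. -/
lemma cell_coe (n : ℕ) (x : ℝ) : cell r n x = (⌊(r : ℝ) ^ n * x⌋ : ℤ) := by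
  have e : (r : ℝ) ^ n * x = (r : ℝ) ^ n * Int.fract x + ((r ^ n * ⌊x⌋ : ℤ) : ℝ) := by
    push_cast
    rw [← mul_add, Int.fract_add_floor]
  rw [cell, unitRep_coe, e, Int.floor_add_intCast, Int.cast_add]
  have : ((r ^ n * ⌊x⌋ : ℤ) : ZMod (r ^ n)) = 0 := by
    have h := ZMod.natCast_self (r ^ n)
    push_cast at h ⊢
    rw [h, zero_mul]
  rw [this, add_zero]

/-- The floor of a sum exceeds the sum of the floors by `0` or `1`: this is the carry. -/
lemma cell_add (n : ℕ) (s t : UnitAddCircle) :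
    cell r n (s + t) = cell r n s + cell r n t ∨
      cell r n (s + t) = cell r n s + cell r n t + 1 := by
  induction s using QuotientAddGroup.induction_on with | H x => ?_
  induction t using QuotientAddGroup.induction_on with | H y => ?_
  change cell r n ((x + y : ℝ) : UnitAddCircle) = cell r n (x : UnitAddCircle) +
    cell r n (y : UnitAddCircle) ∨ cell r n ((x + y : ℝ) : UnitAddCircle) =
      cell r n (x : UnitAddCircle) + cell r n (y : UnitAddCircle) + 1
  simp only [cell_coe, mul_add]
  set a := (r : ℝ) ^ n * x
  set b := (r : ℝ) ^ n * y
  have h1 := Int.le_floor_add a b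
  have h2 := Int.le_floor_add_floor a b
  have h : ⌊a + b⌋ = ⌊a⌋ + ⌊b⌋ ∨ ⌊a + b⌋ = ⌊a⌋ + ⌊b⌋ + 1 := by omega
  rcases h with h | h <;> simp [h]

lemma cell_add_div [NeZero r] (n k : ℕ) (t : UnitAddCircle) :
    cell r n (t + ((k / (r : ℝ) ^ n : ℝ) : UnitAddCircle)) = cell r n t + k := by
  have hr : (r : ℝ) ≠ 0 := Nat.cast_ne_zero.2 (NeZero.ne r)
  induction t using QuotientAddGroup.induction_on with | H x => ?_
  change cell r n ((x + k / (r : ℝ) ^ n : ℝ) : UnitAddCircle) = cell r n (x : UnitAddCircle) + k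
  rw [cell_coe, cell_coe, mul_add, mul_div_cancel₀ _ (pow_ne_zero _ hr), Int.floor_add_natCast]
  simp

lemma isPartition_cell (n : ℕ) : IsPartition (cell r n) :=
  (isPartition_of_measurable (P := fun t => ⌊(r : ℝ) ^ n * unitRep t⌋)
    (Int.measurable_floor.comp (measurable_unitRep.const_mul _))).comp fun k => (k : ZMod (r ^ n))

/-- Translations by multiples of `r ^ (-n)` permute the `r ^ n` cells transitively and preserve
Lebesgue measure. -/
lemma volume_cell [NeZero r] (n : ℕ) (c : ZMod (r ^ n)) :
    (volume : Measure UnitAddCircle).real (cell r n ⁻¹' {c}) = ((r : ℝ) ^ n)⁻¹ := by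
  have : IsProbabilityMeasure (volume : Measure UnitAddCircle) := ⟨UnitAddCircle.measure_univ⟩
  have hc : ∀ c, (volume : Measure UnitAddCircle).real (cell r n ⁻¹' {c}) =
      (volume : Measure UnitAddCircle).real (cell r n ⁻¹' {0}) := fun c => by
    have : cell r n ⁻¹' {0} =
        (fun t => t + ((c.val / (r : ℝ) ^ n : ℝ) : UnitAddCircle)) ⁻¹' (cell r n ⁻¹' {c}) := by
      ext t
      rw [Set.mem_preimage, Set.mem_preimage, Set.mem_preimage, Set.mem_singleton_iff,
        Set.mem_singleton_iff, cell_add_div, ZMod.natCast_zmod_val, add_eq_right]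
    rw [this, measureReal_def, measureReal_def, measure_preimage_add_right]
  have hs := sum_measureReal_fibre (μ := (volume : Measure UnitAddCircle)) (isPartition_cell r n)
  simp_rw [hc] at hs ⊢
  rw [Finset.sum_const, Finset.card_univ, ZMod.card, nsmul_eq_mul] at hs
  push_cast at hs
  exact eq_inv_of_mul_eq_one_right hs

/-- The first digit of a point of the circle. -/
noncomputable def circleDigit [NeZero r] (t : UnitAddCircle) : Fin r := Real.digits (unitRep t) r 0

lemma isPartition_circleDigit [NeZero r] : IsPartition (circleDigit r) :=
  (isPartition_of_measurable (P := fun t => ⌊unitRep t * (r : ℝ) ^ (0 + 1)⌋₊)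
    (Nat.measurable_floor.comp (measurable_unitRep.mul_const _))).comp fun k => Fin.ofNat r k

lemma circleMul_iterate_coe (n : ℕ) (x : ℝ) :
    (circleMul r)^[n] (x : UnitAddCircle) = ((r ^ n * x : ℝ) : UnitAddCircle) := by
  induction n with
  | zero => simp
  | succ n ih =>
    rw [Function.iterate_succ_apply', ih, circleMul, ← AddCircle.coe_nsmul, nsmul_eq_mul, pow_succ']
    ring_nf

lemma circleDigit_iterate [NeZero r] (n : ℕ) (x : ℝ) :
    circleDigit r ((circleMul r)^[n] (x : UnitAddCircle)) = digitAlias r x n := by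
  rw [circleMul_iterate_coe, circleDigit, unitRep_coe, digitAlias, Real.digits, Real.digits]
  set y := (r : ℝ) ^ n * Int.fract x with hy
  have hy0 : 0 ≤ y := mul_nonneg (by positivity) (Int.fract_nonneg x)
  have e : Int.fract ((r : ℝ) ^ n * x) = Int.fract y := by
    rw [hy, Int.fract_eq_fract]
    exact ⟨r ^ n * ⌊x⌋, by rw [Int.fract]; push_cast; ring⟩
  -- The integer split off is a multiple of `r`, so it does not affect the digit.
  have e2 : Int.fract x * (r : ℝ) ^ (n + 1) =
      Int.fract y * (r : ℝ) ^ (0 + 1) + ((⌊y⌋₊ * r : ℕ) : ℝ) := by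
    have : Int.fract y + ⌊y⌋₊ = y := by
      rw [natCast_floor_eq_intCast_floor hy0, Int.fract_add_floor]
    push_cast
    rw [pow_one, ← add_mul, this, hy]
    ring
  rw [e, e2, Nat.floor_add_natCast (mul_nonneg (Int.fract_nonneg _) (by positivity))]
  ext
  simp

lemma fract_mem_Ico (x : ℝ) : Int.fract x ∈ Set.Ico (0 : ℝ) 1 :=
  ⟨Int.fract_nonneg x, Int.fract_lt_one x⟩

lemma cell_eq_wordValue [NeZero r] (n : ℕ) (t : UnitAddCircle) :
    cell r n t = wordValue (iteratedPartition (circleMul r) (circleDigit r) n t) := by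
  induction t using QuotientAddGroup.induction_on with | H x => ?_
  have e : iteratedPartition (circleMul r) (circleDigit r) n (x : UnitAddCircle) =
      fun i : Fin n => digitAlias r x i := funext fun i => circleDigit_iterate r i x
  change cell r n (x : UnitAddCircle) = wordValue
    (iteratedPartition (circleMul r) (circleDigit r) n (x : UnitAddCircle))
  rw [e, wordValue_eq_floor (digitAlias r x) n, digitAlias,
    Real.ofDigits_digits_sum_eq (fract_mem_Ico x), Int.floor_natCast, cell, unitRep_coe,
    ← Int.natCast_floor_eq_floor (mul_nonneg (by positivity) (Int.fract_nonneg _))]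

/-- The point of the circle with given digits. -/
noncomputable def digitsToCircle (ω : ℕ → Fin r) : UnitAddCircle := (Real.ofDigits ω : ℝ)

lemma continuous_digitsToCircle : Continuous (digitsToCircle r) :=
  (AddCircle.continuous_mk' 1).comp Real.continuous_ofDigits

lemma digitsToCircle_digitAlias [NeZero r] (hr : 2 ≤ r) (x : ℝ) :
    digitsToCircle r (digitAlias r x) = x := by
  rw [digitsToCircle, digitAlias, Real.ofDigits_digits hr (fract_mem_Ico x), ← unitRep_coe,
    coe_unitRep]

lemma semiconj_digitsToCircle [NeZero r] :
    Function.Semiconj (digitsToCircle r) shift (circleMul r) := fun ω => by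
  have hr : (r : ℝ) ≠ 0 := Nat.cast_ne_zero.2 (NeZero.ne r)
  rw [digitsToCircle, digitsToCircle, circleMul, ← AddCircle.coe_nsmul, nsmul_eq_mul,
    Real.ofDigits_eq_sum_add_ofDigits ω 1]
  have : (r : ℝ) * (∑ i ∈ Finset.range 1, Real.ofDigitsTerm ω i +
      ((r : ℝ) ^ 1)⁻¹ * Real.ofDigits fun i => ω (i + 1)) =
      Real.ofDigits (shift ω) + ((ω 0 : ℕ) : ℝ) := by
    simp [Real.ofDigitsTerm]
    field_simp
    rw [add_comm]; rfl
  rw [this, AddCircle.coe_add]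
  have h0 : (((ω 0 : ℕ) : ℝ) : UnitAddCircle) = 0 := by
    rw [AddCircle.coe_eq_zero_iff]
    exact ⟨(ω 0 : ℕ), by simp⟩
  rw [h0, add_zero]

/-- The tail of the expansion has value in `[0, 1]`. The value `1`, which an endless run of digits
`r - 1` gives when `2 ≤ r`, pushes the point into the next cell. -/
lemma cell_digitsToCircle [NeZero r] (n : ℕ) (ω : ℕ → Fin r) :
    cell r n (digitsToCircle r ω) = wordValue (fun i : Fin n => ω i) ∨
      cell r n (digitsToCircle r ω) = wordValue (fun i : Fin n => ω i) + 1 := by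
  have hr : (r : ℝ) ≠ 0 := Nat.cast_ne_zero.2 (NeZero.ne r)
  rw [digitsToCircle, cell_coe, wordValue_eq_floor, Real.ofDigits_eq_sum_add_ofDigits ω n, mul_add,
    mul_inv_cancel_left₀ (pow_ne_zero _ hr), pow_mul_sum_ofDigitsTerm]
  set k := ((finFunctionFinEquiv fun i : Fin n => ω i.rev : Fin (r ^ n)) : ℕ)
  set θ := Real.ofDigits fun i => ω (i + n)
  have h0 : 0 ≤ θ := Real.ofDigits_nonneg _
  have h1 : θ ≤ 1 := Real.ofDigits_le_one _
  rw [Int.floor_natCast_add, Int.floor_natCast]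
  rcases h1.lt_or_eq with h1 | h1
  · left; rw [Int.floor_eq_zero_iff.2 ⟨h0, h1⟩, add_zero]
  · right; rw [h1]; simp

end Circle

/-! ### The generators of the shift and of the circle map -/

section Generators

variable (r : ℕ) [NeZero r]

omit [NeZero r] in
lemma continuous_circleMul : Continuous (circleMul r) := continuous_nsmul r

lemma continuous_shift {A : Type*} [TopologicalSpace A] :
    Continuous (shift : (ℕ → A) → (ℕ → A)) := continuous_pi fun n => continuous_apply (n + 1)

lemma shift_iterate {A : Type*} (n : ℕ) (ω : ℕ → A) : shift^[n] ω = fun i => ω (i + n) := by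
  induction n generalizing ω with
  | zero => rfl
  | succ n ih => rw [Function.iterate_succ_apply, ih]; rfl

lemma iteratedPartition_shift {A : Type*} (n : ℕ) (ω : ℕ → A) :
    iteratedPartition shift (fun ω : ℕ → A => ω 0) n ω = fun i : Fin n => ω i := by
  funext i
  simp [iteratedPartition, shift_iterate]

omit [NeZero r] in
lemma isGenerator_shift :
    IsGenerator (shift : (ℕ → Fin r) → (ℕ → Fin r)) (fun ω => ω 0) where
  isPartition := isPartition_of_measurable (measurable_pi_apply 0)
  le_generateFrom := by
    refine iSup_le fun i => ?_
    rintro _ ⟨s, -, rfl⟩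
    refine MeasurableSpace.measurableSet_generateFrom
      ⟨i + 1, {B | B (Fin.last i) ∈ s}, ?_⟩
    ext ω
    simp [iteratedPartition_shift]

lemma isGenerator_circleDigit (hr : 2 ≤ r) : IsGenerator (circleMul r) (circleDigit r) where
  isPartition := isPartition_circleDigit r
  le_generateFrom := by
    have h1 : Measurable[MeasurableSpace.generateFrom
        (cylinderSets (circleMul r) (circleDigit r))]
        (fun (t : UnitAddCircle) (n : ℕ) => circleDigit r ((circleMul r)^[n] t)) := by
      refine @measurable_pi_lambda _ _ _ (_) _ _ fun n s _ => ?_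
      exact MeasurableSpace.measurableSet_generateFrom
        ⟨n + 1, {B | B (Fin.last n) ∈ s}, by ext t; simp [iteratedPartition]⟩
    have h2 := (continuous_digitsToCircle r).measurable.comp h1
    -- A point is a measurable function of its digits, so the identity is measurable from the
    -- σ-algebra that the digits generate.
    have h3 : (digitsToCircle r ∘ fun (t : UnitAddCircle) (n : ℕ) =>
        circleDigit r ((circleMul r)^[n] t)) = id := by
      funext t
      induction t using QuotientAddGroup.induction_on with | H x => ?_
      have : (fun n => circleDigit r ((circleMul r)^[n] (x : UnitAddCircle))) = digitAlias r x :=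
        funext fun n => circleDigit_iterate r n x
      exact (congrArg _ this).trans (digitsToCircle_digitAlias r hr x)
    rw [h3] at h2
    exact fun s hs => h2 hs

end Generators

/-! ### Entropy of sums of points -/

section Main

variable {r : ℕ} [NeZero r]

/-- Digit words and cells are relabellings of each other, and the digit partition generates. -/
lemma measureEntropy_circleMul (hr : 2 ≤ r) {μ : Measure UnitAddCircle} [IsProbabilityMeasure μ]
    (hμ : MeasurePreserving (circleMul r) μ μ) :
    measureEntropy μ (circleMul r) = entropyRate fun n => shannonEntropy μ (cell r n) := by
  rw [(isGenerator_circleDigit r hr).measureEntropy_eq hμ]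
  refine le_antisymm (entropyRate_le (d := 0) fun n => ?_) (entropyRate_le (d := 0) fun n => ?_)
  · rw [add_zero]
    refine shannonEntropy_le_of_factor (isPartition_cell r n) (Function.invFun wordValue)
      fun t => ?_
    rw [cell_eq_wordValue, Function.leftInverse_invFun wordValue_injective]
  · rw [add_zero]
    exact shannonEntropy_le_of_factor
      ((isPartition_circleDigit r).iteratedPartition hμ.measurable n) wordValue
      fun t => cell_eq_wordValue r n t

/-- If the cells of `w` are determined by those of `u` and `v` up to two choices, the entropy of
the distribution of `w` is at most the sum of the entropies of those of `u` and `v`. -/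
lemma measureEntropy_map_le_add (hr : 2 ≤ r) {Ω : Type*} [MeasurableSpace Ω] {μ : Measure Ω}
    [IsProbabilityMeasure μ] {S : Ω → Ω} (hS : MeasurePreserving S μ μ)
    {u v w : Ω → UnitAddCircle} (hu : Measurable u) (hv : Measurable v) (hw : Measurable w)
    (hSu : Function.Semiconj u S (circleMul r)) (hSv : Function.Semiconj v S (circleMul r))
    (hSw : Function.Semiconj w S (circleMul r))
    (g₀ g₁ : ∀ n, ZMod (r ^ n) → ZMod (r ^ n) → ZMod (r ^ n))
    (h : ∀ n ω, cell r n (w ω) = g₀ n (cell r n (u ω)) (cell r n (v ω)) ∨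
      cell r n (w ω) = g₁ n (cell r n (u ω)) (cell r n (v ω))) :
    measureEntropy (μ.map w) (circleMul r) ≤
      measureEntropy (μ.map u) (circleMul r) + measureEntropy (μ.map v) (circleMul r) := by
  have hpres : ∀ {f : Ω → UnitAddCircle}, Measurable f → Function.Semiconj f S (circleMul r) →
      MeasurePreserving (circleMul r) (μ.map f) (μ.map f) := fun {f} hf hsemi => by
    have hT := (continuous_circleMul r).measurable
    refine ⟨hT, ?_⟩
    rw [Measure.map_map hT hf, ← hsemi.comp_eq, ← Measure.map_map hf hS.measurable, hS.map_eq]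
  have := Measure.isProbabilityMeasure_map (μ := μ) hu.aemeasurable
  have := Measure.isProbabilityMeasure_map (μ := μ) hv.aemeasurable
  have := Measure.isProbabilityMeasure_map (μ := μ) hw.aemeasurable
  rw [measureEntropy_circleMul hr (hpres hu hSu), measureEntropy_circleMul hr (hpres hv hSv),
    measureEntropy_circleMul hr (hpres hw hSw)]
  refine entropyRate_le_add (d := 1) fun n => ?_
  have hc := isPartition_cell r n
  rw [shannonEntropy_map μ hu hc, shannonEntropy_map μ hv hc, shannonEntropy_map μ hw hc]
  have hcu := hc.comp_measurable hu
  have hcv := hc.comp_measurable hv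
  exact (shannonEntropy_le_add_one (hc.comp_measurable hw) (hcu.prodMk hcv)
    (fun c => g₀ n c.1 c.2) (fun c => g₁ n c.1 c.2) (h n)).trans
      (add_le_add_left (shannonEntropy_prodMk_le hcu hcv) 1)

/-- The entropy of a measure on the circle. -/
local notation "ent" => fun μ : ProbabilityMeasure UnitAddCircle =>
  measureEntropy (μ : Measure UnitAddCircle) (circleMul r)

lemma semiconj_fst (r : ℕ) : Function.Semiconj (Prod.fst : UnitAddCircle × UnitAddCircle → _)
    (Prod.map (circleMul r) (circleMul r)) (circleMul r) := fun _ => rfl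

lemma semiconj_snd (r : ℕ) : Function.Semiconj (Prod.snd : UnitAddCircle × UnitAddCircle → _)
    (Prod.map (circleMul r) (circleMul r)) (circleMul r) := fun _ => rfl

lemma semiconj_add (r : ℕ) : Function.Semiconj (fun p : UnitAddCircle × UnitAddCircle => p.1 + p.2)
    (Prod.map (circleMul r) (circleMul r)) (circleMul r) := fun p => (nsmul_add p.1 p.2 r).symm

/-- The entropies of the marginals of a joining and of its image under addition. -/
lemma measureEntropy_triangle (hr : 2 ≤ r) {μ : Measure (UnitAddCircle × UnitAddCircle)}
    [IsProbabilityMeasure μ]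
    (hS : MeasurePreserving (Prod.map (circleMul r) (circleMul r)) μ μ) :
    measureEntropy (μ.map fun p => p.1 + p.2) (circleMul r) ≤
        measureEntropy (μ.map Prod.fst) (circleMul r) +
          measureEntropy (μ.map Prod.snd) (circleMul r) ∧
      measureEntropy (μ.map Prod.fst) (circleMul r) ≤
        measureEntropy (μ.map fun p => p.1 + p.2) (circleMul r) +
          measureEntropy (μ.map Prod.snd) (circleMul r) ∧
      measureEntropy (μ.map Prod.snd) (circleMul r) ≤
        measureEntropy (μ.map fun p => p.1 + p.2) (circleMul r) +
          measureEntropy (μ.map Prod.fst) (circleMul r) := by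
  have h1 := semiconj_fst r
  have h2 := semiconj_snd r
  have h3 := semiconj_add r
  have m3 : Measurable fun p : UnitAddCircle × UnitAddCircle => p.1 + p.2 :=
    measurable_fst.add measurable_snd
  refine ⟨?_, ?_, ?_⟩
  · exact measureEntropy_map_le_add hr hS measurable_fst measurable_snd m3 h1 h2 h3
      (fun _ a b => a + b) (fun _ a b => a + b + 1) fun n p => cell_add r n p.1 p.2
  · refine measureEntropy_map_le_add hr hS m3 measurable_snd measurable_fst h3 h2 h1
      -- The addition rule is solved for one summand, with carry `0` or `1`.
      (fun _ a b => a - b) (fun _ a b => a - b - 1) fun n p => ?_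
    rcases cell_add r n p.1 p.2 with h | h
    · left; rw [h]; ring
    · right; rw [h]; ring
  · refine measureEntropy_map_le_add hr hS m3 measurable_fst measurable_snd h3 h1 h2
      (fun _ a b => a - b) (fun _ a b => a - b - 1) fun n p => ?_
    rcases cell_add r n p.1 p.2 with h | h
    · left; rw [h]; ring
    · right; rw [h]; ring

/-- `ν` lifts through addition to a joining quasi-generated by `(x, y)`, whose marginals are
quasi-generated by `x` and `y`. -/
lemma exists_joining_of_add (hr : 2 ≤ r) {x y : UnitAddCircle}
    {ν : ProbabilityMeasure UnitAddCircle} (hν : ν ∈ quasiGenerated (circleMul r) (x + y)) :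
    ∃ μ₁ ∈ quasiGenerated (circleMul r) x, ∃ μ₂ ∈ quasiGenerated (circleMul r) y,
      ent ν ≤ ent μ₁ + ent μ₂ ∧ ent μ₁ ≤ ent ν + ent μ₂ ∧ ent μ₂ ≤ ent ν + ent μ₁ := by
  have hT := continuous_circleMul r
  have hadd : Continuous fun p : UnitAddCircle × UnitAddCircle => p.1 + p.2 := continuous_add
  obtain ⟨μ, hμ, he⟩ := exists_lift_quasiGenerated (x := (x, y)) hadd (semiconj_add r) hν
  have h := measureEntropy_triangle hr (measurePreserving_of_quasiGenerated (hT.prodMap hT) hμ)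
  rw [← ProbabilityMeasure.toMeasure_map μ hadd.measurable.aemeasurable,
    ← ProbabilityMeasure.toMeasure_map μ continuous_fst.measurable.aemeasurable,
    ← ProbabilityMeasure.toMeasure_map μ continuous_snd.measurable.aemeasurable, he] at h
  have h1 := map_mem_quasiGenerated continuous_fst (semiconj_fst r) hμ
  have h2 := map_mem_quasiGenerated continuous_snd (semiconj_snd r) hμ
  exact ⟨_, h1, _, h2, h⟩

/-- Here the lift is through the first projection: a measure of `x` is prescribed and one of `x + y`
is found. -/
lemma exists_joining_of_left (hr : 2 ≤ r) {x : UnitAddCircle} (y : UnitAddCircle)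
    {μ₁ : ProbabilityMeasure UnitAddCircle} (hμ₁ : μ₁ ∈ quasiGenerated (circleMul r) x) :
    ∃ ν ∈ quasiGenerated (circleMul r) (x + y), ∃ μ₂ ∈ quasiGenerated (circleMul r) y,
      ent ν ≤ ent μ₁ + ent μ₂ ∧ ent μ₁ ≤ ent ν + ent μ₂ := by
  have hT := continuous_circleMul r
  have hadd : Continuous fun p : UnitAddCircle × UnitAddCircle => p.1 + p.2 := continuous_add
  obtain ⟨μ, hμ, he⟩ := exists_lift_quasiGenerated (x := (x, y)) continuous_fst (semiconj_fst r) hμ₁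
  have h := measureEntropy_triangle hr (measurePreserving_of_quasiGenerated (hT.prodMap hT) hμ)
  rw [← ProbabilityMeasure.toMeasure_map μ hadd.measurable.aemeasurable,
    ← ProbabilityMeasure.toMeasure_map μ continuous_fst.measurable.aemeasurable,
    ← ProbabilityMeasure.toMeasure_map μ continuous_snd.measurable.aemeasurable, he] at h
  have h1 := map_mem_quasiGenerated hadd (semiconj_add r) hμ
  have h2 := map_mem_quasiGenerated continuous_snd (semiconj_snd r) hμ
  exact ⟨_, h1, _, h2, h.1, h.2.1⟩

theorem lowerEntropy_upperEntropy_add (hr : 2 ≤ r) {x y : UnitAddCircle} {hx hy : ℝ≥0∞}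
    (hx₁ : lowerEntropy (circleMul r) x = hx) (hx₂ : upperEntropy (circleMul r) x = hx)
    (hy₁ : lowerEntropy (circleMul r) y = hy) (hy₂ : upperEntropy (circleMul r) y = hy) :
    max (hx - hy) (hy - hx) ≤ lowerEntropy (circleMul r) (x + y) ∧
      lowerEntropy (circleMul r) (x + y) ≤ upperEntropy (circleMul r) (x + y) ∧
      upperEntropy (circleMul r) (x + y) ≤ hx + hy := by
  have hX : ∀ μ ∈ quasiGenerated (circleMul r) x, ent μ = hx := fun μ hμ =>
    le_antisymm (hx₂ ▸ le_iSup₂_of_le μ hμ le_rfl) (hx₁ ▸ iInf₂_le_of_le μ hμ le_rfl)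
  have hY : ∀ μ ∈ quasiGenerated (circleMul r) y, ent μ = hy := fun μ hμ =>
    le_antisymm (hy₂ ▸ le_iSup₂_of_le μ hμ le_rfl) (hy₁ ▸ iInf₂_le_of_le μ hμ le_rfl)
  refine ⟨le_iInf₂ fun ν hν => ?_, ?_, iSup₂_le fun ν hν => ?_⟩
  · obtain ⟨μ₁, h₁, μ₂, h₂, -, h, h'⟩ := exists_joining_of_add hr hν
    simp only [hX μ₁ h₁, hY μ₂ h₂] at h h'
    exact max_le (tsub_le_iff_right.2 h) (tsub_le_iff_right.2 h')
  · obtain ⟨ν, hν⟩ := quasiGenerated_nonempty (circleMul r) (x + y)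
    exact (iInf₂_le ν hν).trans (le_iSup₂ (f := fun μ _ => ent μ) ν hν)
  · obtain ⟨μ₁, h₁, μ₂, h₂, h, -⟩ := exists_joining_of_add hr hν
    simpa only [hX μ₁ h₁, hY μ₂ h₂] using h

/-- Adding a deterministic point does not change the entropies of the quasi-generated measures. -/
lemma image_entropy_add_deterministic (hr : 2 ≤ r) {y : UnitAddCircle}
    (hy : y ∈ circleDeterministic r) (x : UnitAddCircle) :
    ent '' quasiGenerated (circleMul r) (x + y) = ent '' quasiGenerated (circleMul r) x := by
  ext h
  constructor
  · rintro ⟨ν, hν, rfl⟩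
    obtain ⟨μ₁, h₁, μ₂, h₂, h, h', -⟩ := exists_joining_of_add hr hν
    simp only [hy μ₂ h₂, add_zero] at h h'
    exact ⟨μ₁, h₁, le_antisymm h' h⟩
  · rintro ⟨μ₁, h₁, rfl⟩
    obtain ⟨ν, hν, μ₂, h₂, h, h'⟩ := exists_joining_of_left hr y h₁
    simp only [hy μ₂ h₂, add_zero] at h h'
    exact ⟨ν, hν, le_antisymm h h'⟩

omit [NeZero r] in
lemma mem_circleDeterministic_iff_image {t : UnitAddCircle} : t ∈ circleDeterministic r ↔
    ∀ h ∈ ent '' quasiGenerated (circleMul r) t, h = 0 := by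
  rw [Set.forall_mem_image]; rfl

/-- The fixed point `0` quasi-generates only the point mass at `0`, for which every partition has
zero entropy. -/
lemma zero_mem_circleDeterministic (hr : 2 ≤ r) : (0 : UnitAddCircle) ∈ circleDeterministic r := by
  intro μ hμ
  have hinv := measurePreserving_of_quasiGenerated (continuous_circleMul r) hμ
  obtain ⟨J, hJ, hgen⟩ := hμ
  have hfix : Function.IsFixedPt (circleMul r) 0 := smul_zero r
  have hd : μ = ⟨Measure.dirac 0, inferInstance⟩ := probabilityMeasure_ext fun f => by
    have hf : StronglyMeasurable f :=
      f.continuous.stronglyMeasurable_of_hasCompactSupport (HasCompactSupport.of_compactSpace f)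
    refine tendsto_nhds_unique (hgen f) (tendsto_const_nhds.congr' ?_)
    filter_upwards [eventually_gt_atTop 0] with k hk
    -- At time `0` the Birkhoff average is `0` by convention, so that index is avoided.
    have : J k ≠ 0 := ((Nat.zero_le _).trans_lt (hJ hk)).ne'
    rw [hfix.birkhoffAverage_eq ℝ f (Nat.cast_ne_zero.2 this)]
    exact integral_dirac' _ _ hf
  rw [measureEntropy_circleMul hr hinv, ← nonpos_iff_eq_zero, ← ENNReal.ofReal_zero,
    ← entropyRate_mul_nat 0]
  refine entropyRate_le (d := 0) fun n => ?_
  rw [hd, shannonEntropy_eq, mul_zero, add_zero]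
  refine div_nonpos_of_nonpos_of_nonneg (Finset.sum_nonpos fun c _ => ?_)
    (Real.log_nonneg (by norm_num))
  rw [ProbabilityMeasure.coe_mk, measureReal_def, Measure.dirac_apply' _ (isPartition_cell r n _)]
  by_cases h : (0 : UnitAddCircle) ∈ cell r n ⁻¹' {c} <;> simp [h]

lemma add_mem_circleDeterministic_iff (hr : 2 ≤ r) {y : UnitAddCircle}
    (hy : y ∈ circleDeterministic r) (x : UnitAddCircle) :
    x + y ∈ circleDeterministic r ↔ x ∈ circleDeterministic r := by
  rw [mem_circleDeterministic_iff_image, mem_circleDeterministic_iff_image,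
    image_entropy_add_deterministic hr hy]

/-- The group of the deterministic points of the circle. -/
def circleDeterministicSubgroup (hr : 2 ≤ r) : AddSubgroup UnitAddCircle where
  carrier := circleDeterministic r
  zero_mem' := zero_mem_circleDeterministic hr
  add_mem' {x y} hx hy := (add_mem_circleDeterministic_iff hr hy x).2 hx
  neg_mem' {x} hx := (add_mem_circleDeterministic_iff hr hx (-x)).1 (by
    rw [neg_add_cancel]; exact zero_mem_circleDeterministic hr)

lemma preservers_addSubgroup {G : Type*} [AddGroup G] (H : AddSubgroup G) :
    preservers (H : Set G) = H := by
  ext y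
  exact ⟨fun h => by simpa using h 0 H.zero_mem, fun hy x hx => H.add_mem hx hy⟩

theorem mem_circleDeterministic_iff (hr : 2 ≤ r) (y : UnitAddCircle) :
    y ∈ circleDeterministic r ↔ ∀ x : UnitAddCircle,
      lowerEntropy (circleMul r) (x + y) = lowerEntropy (circleMul r) x ∧
        upperEntropy (circleMul r) (x + y) = upperEntropy (circleMul r) x := by
  constructor
  · intro hy x
    have h := image_entropy_add_deterministic hr hy x
    constructor
    · simpa only [lowerEntropy, sInf_image] using congrArg sInf h
    · simpa only [upperEntropy, sSup_image] using congrArg sSup h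
  · intro h μ hμ
    -- The case `x = 0` suffices: `y = 0 + y` has the upper entropy of `0`.
    have h0 := (h 0).2
    rw [zero_add] at h0
    have hz : upperEntropy (circleMul r) (0 : UnitAddCircle) ≤ 0 :=
      iSup₂_le fun ν hν => (zero_mem_circleDeterministic hr ν hν).le
    rw [← h0] at hz
    exact nonpos_iff_eq_zero.1 ((le_iSup₂ (f := fun μ _ => ent μ) μ hμ).trans hz)

/-! ### Normality as maximal entropy -/

lemma circleLebesgue_fibre (n : ℕ) (B : Fin n → Fin r) :
    (circleLebesgue : Measure UnitAddCircle).real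
      (iteratedPartition (circleMul r) (circleDigit r) n ⁻¹' {B}) =
        ((Fintype.card (Fin r) : ℝ) ^ n)⁻¹ := by
  rw [Fintype.card_fin, ← volume_cell r n (wordValue B)]
  congr 1
  ext t
  simp [cell_eq_wordValue, wordValue_injective.eq_iff]

/-- The maximal entropy `log₂ r`. -/
noncomputable def maxEntropy (r : ℕ) : ℝ≥0∞ :=
  ENNReal.ofReal (Real.log (Fintype.card (Fin r)) / Real.log 2)

/-- An invariant measure with entropy at least `log₂ r` gives equal mass to all cylinders of each
length, hence is Lebesgue measure. Normality thus becomes a condition on entropies alone. -/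
lemma mem_circleNormal_iff (hr : 2 ≤ r) (t : UnitAddCircle) :
    t ∈ circleNormal r ↔ ∀ μ ∈ quasiGenerated (circleMul r) t, maxEntropy r ≤ ent μ := by
  have hα := isGenerator_circleDigit r hr
  refine isGeneric_iff.trans (forall₂_congr fun μ hμ => ?_)
  have hinv := measurePreserving_of_quasiGenerated (continuous_circleMul r) hμ
  refine Iff.trans ?_ (hα.log_le_measureEntropy_iff hinv).symm
  constructor
  · rintro rfl
    exact circleLebesgue_fibre
  · exact fun h => Subtype.ext (hα.measure_ext (μ := (μ : Measure UnitAddCircle))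
      (ν := (circleLebesgue : Measure UnitAddCircle)) hinv.measurable fun n B =>
      (h n B).trans (circleLebesgue_fibre n B).symm)

theorem circleDeterministic_subset_preservers_circleNormal (hr : 2 ≤ r) :
    circleDeterministic r ⊆ preservers (circleNormal r) := fun y hy x hx => by
  rw [mem_circleNormal_iff hr] at hx ⊢
  have h := image_entropy_add_deterministic hr hy x
  intro ν hν
  obtain ⟨μ, hμ, he⟩ := h.subset ⟨ν, hν, rfl⟩
  exact (hx μ hμ).trans_eq he

/-! ### Transfer to digits of real numbers -/

/-- A factor has no more entropy. Conversely, the cell of the image determines the word up to two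
choices, so nothing is lost in the rate, even if the measure charges sequences with ambiguous
expansions. -/
lemma measureEntropy_map_digitsToCircle (hr : 2 ≤ r) {ω : ℕ → Fin r}
    {ν : ProbabilityMeasure (ℕ → Fin r)} (hν : ν ∈ quasiGenerated shift ω) :
    ent (ν.map (continuous_digitsToCircle r).measurable.aemeasurable) =
      measureEntropy (ν : Measure (ℕ → Fin r)) shift := by
  have hφ := (continuous_digitsToCircle r).measurable
  have hinv := measurePreserving_of_quasiGenerated continuous_shift hν
  have hinv' := measurePreserving_of_quasiGenerated (continuous_circleMul r)
    (map_mem_quasiGenerated (continuous_digitsToCircle r) (semiconj_digitsToCircle r) hν)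
  refine le_antisymm (measureEntropy_map_le hφ hinv'.measurable (semiconj_digitsToCircle r)) ?_
  change _ ≤ measureEntropy _ _
  rw [measureEntropy_circleMul hr hinv', (isGenerator_shift r).measureEntropy_eq hinv]
  refine entropyRate_le (d := 1) fun n => ?_
  have hc := isPartition_cell r n
  rw [ProbabilityMeasure.toMeasure_map, shannonEntropy_map _ hφ hc]
  refine shannonEntropy_le_add_one
    ((isGenerator_shift r).isPartition.iteratedPartition hinv.measurable n)
    (hc.comp_measurable hφ) (fun c => Function.invFun wordValue c)
    (fun c => Function.invFun wordValue (c - 1)) fun ω => ?_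
  rw [iteratedPartition_shift]
  rcases cell_digitsToCircle r n ω with h | h
  · left; rw [h, Function.leftInverse_invFun wordValue_injective]
  · right; rw [h, add_sub_cancel_right, Function.leftInverse_invFun wordValue_injective]

/-- A real number modulo one and its digits quasi-generate measures with the same entropies. -/
lemma image_entropy_digitAlias (hr : 2 ≤ r) (x : ℝ) :
    ent '' quasiGenerated (circleMul r) (x : UnitAddCircle) =
      (fun ν : ProbabilityMeasure (ℕ → Fin r) => measureEntropy (ν : Measure (ℕ → Fin r)) shift) ''
        quasiGenerated shift (digitAlias r x) := by
  ext h
  constructor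
  · rintro ⟨μ, hμ, rfl⟩
    rw [← digitsToCircle_digitAlias r hr x] at hμ
    obtain ⟨ν, hν, rfl⟩ := exists_lift_quasiGenerated (continuous_digitsToCircle r)
      (semiconj_digitsToCircle r) hμ
    exact ⟨ν, hν, (measureEntropy_map_digitsToCircle hr hν).symm⟩
  · rintro ⟨ν, hν, rfl⟩
    refine ⟨_, ?_, measureEntropy_map_digitsToCircle hr hν⟩
    have := map_mem_quasiGenerated (continuous_digitsToCircle r) (semiconj_digitsToCircle r) hν
    rwa [digitsToCircle_digitAlias r hr] at this

lemma mem_deterministicNumbers_iff (hr : 2 ≤ r) (x : ℝ) :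
    x ∈ deterministicNumbers r ↔ (x : UnitAddCircle) ∈ circleDeterministic r := by
  rw [mem_circleDeterministic_iff_image, image_entropy_digitAlias hr, Set.forall_mem_image]
  rfl

omit [NeZero r] in
-- Cylinders are clopen, so their indicators are continuous and block frequencies are Birkhoff
-- averages of test functions.
lemma isNormalSeq_iff_quasiGenerated (ω : ℕ → Fin r) : IsNormalSeq ω ↔
    ∀ ν ∈ quasiGenerated shift ω, ∀ (k : ℕ) (B : Fin k → Fin r),
      (ν : Measure (ℕ → Fin r)).real
        (iteratedPartition shift (fun ω : ℕ → Fin r => ω 0) k ⁻¹' {B}) = ((r : ℝ) ^ k)⁻¹ := by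
  classical
  let C : ∀ k, (Fin k → Fin r) → Set (ℕ → Fin r) := fun k B => (fun ω (i : Fin k) => ω i) ⁻¹' {B}
  have hC : ∀ k (B : Fin k → Fin r), IsClopen (C k B) := fun k B =>
    (isClopen_discrete {B}).preimage (continuous_pi fun i => continuous_apply (i : ℕ))
  have hCe : ∀ k (B : Fin k → Fin r),
      iteratedPartition shift (fun ω : ℕ → Fin r => ω 0) k ⁻¹' {B} = C k B := fun k B => by
    ext ω
    simp [C, iteratedPartition_shift]
  let f : ∀ k, (Fin k → Fin r) → C(ℕ → Fin r, ℝ) := fun k B =>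
    ⟨(C k B).indicator 1, (hC k B).continuous_indicator continuous_one⟩
  have hint : ∀ k B (ν : ProbabilityMeasure (ℕ → Fin r)),
      ∫ z, f k B z ∂(ν : Measure (ℕ → Fin r)) = (ν : Measure (ℕ → Fin r)).real (C k B) :=
    fun k B ν => integral_indicator_one (hC k B).isOpen.measurableSet
  have havg : ∀ k B n, birkhoffAverage ℝ shift (f k B) n ω =
      (((Finset.range n).filter (fun i => ∀ j : Fin k, ω (i + j) = B j)).card : ℝ) / n := by
    intro k B n
    rw [birkhoffAverage, birkhoffSum, smul_eq_mul, ← div_eq_inv_mul, Finset.card_filter]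
    push_cast
    congr 1
    refine Finset.sum_congr rfl fun i _ => ?_
    change (C k B).indicator 1 (shift^[i] ω) = _
    rw [shift_iterate, Set.indicator_apply]
    simp only [C, Set.mem_preimage, Set.mem_singleton_iff, funext_iff, add_comm i, Pi.one_apply]
  constructor
  · rintro h ν ⟨J, hJ, hν⟩ k B
    rw [hCe, ← hint]
    refine tendsto_nhds_unique (hν (f k B)) ?_
    simp_rw [havg]
    exact (h k B).comp hJ.tendsto_atTop
  · intro h k B
    simp_rw [← havg]
    refine tendsto_birkhoffAverage_of_quasiGenerated fun ν hν => ?_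
    rw [hint, ← hCe]
    exact h ν hν k B

/-- Both sides say that all quasi-generated measures have entropy at least `log₂ r`, on the shift
and on the circle, and the two sets of entropies agree. -/
lemma mem_normalNumbers_iff (hr : 2 ≤ r) (x : ℝ) :
    x ∈ normalNumbers r ↔ (x : UnitAddCircle) ∈ circleNormal r := by
  rw [mem_circleNormal_iff hr, ← Set.forall_mem_image (f := ent) (p := fun h => maxEntropy r ≤ h),
    image_entropy_digitAlias hr, Set.forall_mem_image]
  refine (isNormalSeq_iff_quasiGenerated _).trans (forall₂_congr fun ν hν => ?_)
  have hinv := measurePreserving_of_quasiGenerated continuous_shift hν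
  have := (isGenerator_shift r).log_le_measureEntropy_iff hinv
  rw [Fintype.card_fin] at this
  rw [maxEntropy, Fintype.card_fin]
  exact this.symm

/-- The group of the deterministic real numbers. -/
def deterministicSubgroup (hr : 2 ≤ r) : AddSubgroup ℝ :=
  (circleDeterministicSubgroup hr).comap (QuotientAddGroup.mk' (AddSubgroup.zmultiples (1 : ℝ)))

lemma coe_deterministicSubgroup (hr : 2 ≤ r) :
    (deterministicSubgroup hr : Set ℝ) = deterministicNumbers r :=
  Set.ext fun x => (mem_deterministicNumbers_iff hr x).symm

theorem deterministicNumbers_subset_preservers_normalNumbers (hr : 2 ≤ r) :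
    deterministicNumbers r ⊆ preservers (normalNumbers r) := fun y hy x hx => by
  rw [mem_deterministicNumbers_iff hr] at hy
  rw [mem_normalNumbers_iff hr] at hx ⊢
  rw [AddCircle.coe_add]
  exact circleDeterministic_subset_preservers_circleNormal hr hy _ hx

end Main

end NormDet

theorem mainTheorem3 (r : ℕ) [NeZero r] (hr : 2 ≤ r) :
    -- real numbers
    (NormDet.deterministicNumbers r ⊆ NormDet.preservers (NormDet.normalNumbers r) ∧
      NormDet.deterministicNumbers r = NormDet.preservers (NormDet.deterministicNumbers r) ∧
      ∃ H : AddSubgroup ℝ, (H : Set ℝ) = NormDet.deterministicNumbers r) ∧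
    -- entropy of a sum of two points of the circle that have entropies `h(x)` and `h(y)`;
    -- the maximum of the two truncated differences is `|h(x) - h(y)|`
    (∀ x y : UnitAddCircle, ∀ hx hy : ℝ≥0∞,
      NormDet.lowerEntropy (NormDet.circleMul r) x = hx →
      NormDet.upperEntropy (NormDet.circleMul r) x = hx →
      NormDet.lowerEntropy (NormDet.circleMul r) y = hy →
      NormDet.upperEntropy (NormDet.circleMul r) y = hy →
        max (hx - hy) (hy - hx) ≤ NormDet.lowerEntropy (NormDet.circleMul r) (x + y) ∧
        NormDet.lowerEntropy (NormDet.circleMul r) (x + y) ≤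
          NormDet.upperEntropy (NormDet.circleMul r) (x + y) ∧
        NormDet.upperEntropy (NormDet.circleMul r) (x + y) ≤ hx + hy) ∧
    -- deterministic points of the circle
    (∀ y : UnitAddCircle,
      y ∈ NormDet.circleDeterministic r ↔
        ∀ x : UnitAddCircle,
          NormDet.lowerEntropy (NormDet.circleMul r) (x + y) =
            NormDet.lowerEntropy (NormDet.circleMul r) x ∧
          NormDet.upperEntropy (NormDet.circleMul r) (x + y) =
            NormDet.upperEntropy (NormDet.circleMul r) x) ∧
    (NormDet.circleDeterministic r ⊆ NormDet.preservers (NormDet.circleNormal r) ∧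
      NormDet.circleDeterministic r = NormDet.preservers (NormDet.circleDeterministic r) ∧
      ∃ H : AddSubgroup UnitAddCircle, (H : Set UnitAddCircle) = NormDet.circleDeterministic r) :=
  ⟨⟨NormDet.deterministicNumbers_subset_preservers_normalNumbers hr,
      NormDet.coe_deterministicSubgroup hr ▸ (NormDet.preservers_addSubgroup _).symm,
      NormDet.deterministicSubgroup hr, NormDet.coe_deterministicSubgroup hr⟩,
    fun _ _ _ _ hx₁ hx₂ hy₁ hy₂ =>
      NormDet.lowerEntropy_upperEntropy_add hr hx₁ hx₂ hy₁ hy₂,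
    NormDet.mem_circleDeterministic_iff hr,
    NormDet.circleDeterministic_subset_preservers_circleNormal hr,
    (NormDet.preservers_addSubgroup (NormDet.circleDeterministicSubgroup hr)).symm,
    NormDet.circleDeterministicSubgroup hr, rfl⟩
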